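/- For integers $n,k\ge 1$, let $\binom{[n]}{k}$ be the set of $k$-element subsets of $[n]=\{1,\dots,n\}$. For a family $S$ of sets of size $r$, its shadow $\Delta(S)$ is the family of all $(r-1)$-element sets contained in some member of $S$; put $\Delta^0(S)=S$ and $\Delta^{i}(S)=\Delta(\Delta^{i-1}(S))$. Every integer $m\ge 1$ has a unique $k$-binomial decomposition, i.e. a sequence $\mathbf a=(a_0,\dots,a_s)$ of integers with $0\le s\le k-1$, $a_0>a_1>\dots>a_s\ge k-s\ge 1$ and $m=\binom{a_0}{k}+\binom{a_1}{k-1}+\dots+\binom{a_s}{k-s}$. For $0\le r\le k$ write $\binom{\mathbf a}{r}=\sum_{i=0}^{s}\binom{a_i}{r-i}$, where $\binom{x}{y}=0$ for $y<0$. A non-empty family $S\subseteq\binom{[n]}{k}$ is extremal if $|\Delta(S)|=\binom{\mathbf a}{k-1}$, where $\mathbf a$ is the $k$-binomial decomposition of $|S|$. Let $I_{n,r}(m)$ be the initial segment of length $m$ of $\binom{[n]}{r}$ in the colexicographic order ($x<y$ if and only if $x \ne y$ and the maximum of the symmetric difference of $x$ and $y$ lies in $y$). Two families of subsets of $[n]$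 are isomorphic ($\cong$) if some permutation of $[n]$ maps one onto the other. The depth of $S\subseteq\binom{[n]}{k}$ is the least $j\in\{0,\dots,k-1\}$ such that $\Delta^j(S)\cong I_{n,k-j}(m)$ for some $m$. Theorem. Let $k\ge 1$. (i) There is a constant $c=c(k)>0$, depending only on $k$, such that for every $n \ge 1$, every extremal family $S\subseteq\binom{[n]}{k}$ with $\mathbf a$ the $k$-binomial decomposition of $|S|$, and every integer $0\le t\le k$ with $t\ge c\log\log n$, we have $\Delta^t(S)\cong I_{n,k-t}\left(\binom{\mathbf a}{k-t}\right)$. (ii) For every $n \ge 1$, every extremal family $S\subseteq\binom{[n]}{k}$ has a (well-defined) depth $j$, and $j\le\max\{\log_2\log_2 n+4,\,5\}$. (For $n=1$, read $\log\log n$ and $\log_2\log_2 n$ as $-\infty$.) -/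

import Mathlib

open scoped FinsetFamily

/-- For a sequence `a = (a 0, …, a (ℓ - 1))` and `r : ℕ`, the number
`C(a 0, r) + C(a 1, r - 1) + ⋯ + C(a (ℓ - 1), r - (ℓ - 1))`,
where a binomial coefficient with negative lower index is `0`. -/
def seqChoose {ℓ : ℕ} (a : Fin ℓ → ℕ) (r : ℕ) : ℕ :=
  ∑ i : Fin ℓ, if (i : ℕ) ≤ r then (a i).choose (r - i) else 0

/-- `a` is the `k`-binomial decomposition of `m`: it has between `1` and `k` terms, is strictly
decreasing, satisfies `a i ≥ k - i` for all `i` (equivalently, for the last index), and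
`m = C(a 0, k) + C(a 1, k - 1) + ⋯`. -/
structure IsBinomialDecomposition (k m : ℕ) {ℓ : ℕ} (a : Fin ℓ → ℕ) : Prop where
  one_le_length : 1 ≤ ℓ
  length_le : ℓ ≤ k
  strictAnti : StrictAnti a
  le_coeff : ∀ i : Fin ℓ, k ≤ a i + i
  sum_eq : seqChoose a k = m

/-- `S` is a non-empty family of `k`-subsets of an `n`-element set whose lower shadow attains the
Kruskal–Katona bound given by the `k`-binomial decomposition of `|S|`. -/
def IsExtremalFamily {n : ℕ} (k : ℕ) (S : Finset (Finset (Fin n))) : Prop :=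
  S.Nonempty ∧ (S : Set (Finset (Fin n))).Sized k ∧
    ∃ (ℓ : ℕ) (a : Fin ℓ → ℕ), IsBinomialDecomposition k S.card a ∧
      (∂ S).card = seqChoose a (k - 1)

/-- Two families of subsets of an `n`-element set are isomorphic if a permutation of the ground set
maps one onto the other. -/
def FamilyIso {n : ℕ} (S T : Finset (Finset (Fin n))) : Prop :=
  ∃ σ : Equiv.Perm (Fin n), S.image (fun s => s.image σ) = T

/-- `I` is the initial segment of length `m` in the colexicographic order on the `r`-subsets of an
`n`-element set (unique when it exists, that is, when `m ≤ C(n, r)`). -/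
def IsColexSegment {n : ℕ} (r m : ℕ) (I : Finset (Finset (Fin n))) : Prop :=
  Finset.Colex.IsInitSeg I r ∧ I.card = m

/-- `T` is isomorphic to the colex initial segment of length `m` among the `r`-subsets. -/
def IsoColexSegment {n : ℕ} (r m : ℕ) (T : Finset (Finset (Fin n))) : Prop :=
  ∃ I : Finset (Finset (Fin n)), IsColexSegment r m I ∧ FamilyIso T I

/-- `j` is the depth of the family `S` of `k`-sets: the least `j` (among `0, …, k - 1`) for which
the `j`-th iterated shadow of `S` is, up to isomorphism, an initial segment of the colex order. -/
def IsDepth {n : ℕ} (k : ℕ) (S : Finset (Finset (Fin n))) (j : ℕ) : Prop :=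
  IsLeast {i : ℕ | i < k ∧ ∃ m : ℕ, IsoColexSegment (k - i) m (∂^[i] S)} j

/-!
The size of a family of `k`-sets is encoded by the colexicographically last member `{b 0 > b 1 > ⋯ >
b (k - 1)}` of the initial segment of this size: the size is `cascade b k = C(b 0, k) + ⋯ + C(b (k -
1), 1) + 1`, and the iterated shadows of the initial segment have the sizes `cascade b r`, `r ≤ k`.
A family `S` is extremal if its first shadow is as small as possible, and then all its iterated
shadows are (`Extremal.card_iterate_shadow`). At each vertex `x`, an extremal family has an extremal
link, which either contains the shadow of the deletion of `x`, or is contained in it, in which case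
the deletion is extremal too (`Extremal.link`).

The heart is `Extremal.pow_le_last_gap`: if, for some `t ≥ 5`, the `t`-th shadow of `S` is not
isomorphic to an initial segment, then `b (k - 2) - b (k - 1) - 1 ≥ 2 * 2 ^ 2 ^ (t - 3)`. As `b 0 <
n`, both parts of the theorem follow. For the proof, take a smallest set `X` of vertices that is not
contained in a member of `S`, and a vertex `x` of `X` such that, for `p` as large as possible, all
sets of at most `p` vertices that avoid `x` are contained in members of `S`. The second alternative
above holds at `x`, and the numbers of faces of `S` are the sums of those of the deletion and of the
link.

If `p` is at least the size `r` of the sets under consideration, then the `r`-faces form a cone over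
the `(r - 1)`-faces of the link, so that the claim for the link, which holds by induction, gives the
claim for `S`; the last gap only grows (`VertexSplit.link_last_gap_le`). Otherwise the sequences
`b`, `c`, `d` of the family, the link and the deletion diverge at the index `p`, and their
generating polynomials satisfy a `DefectRelation` with a nonnegative error polynomial `w`. Passing
to the tails of the sequences turns `w` into a polynomial whose constant coefficient is at least
half the square of the previous one, and this constant coefficient is a lower bound for the gap of
`b`; this is the doubly exponential growth (`DefectRelation.pow_le_last_gap`). It starts unless the
constant coefficient of `w` and the gap of `c` both vanish. In that exceptional case the face
numbers of the link are those of the complex of all sets that do not contain a certain set `Y ⊆ X`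
(`exists_core`), and then a vertex of `Y` would have been a better choice than `x`
(`VertexSplit.pow_le_last_gap`).
-/

open Finset

/-! ### Cascades -/

/-- The sequence `b` is strictly decreasing on the indices `0, …, k - 1`. -/
def DecreasingBelow (k : ℕ) (b : ℕ → ℕ) : Prop :=
  ∀ i, i + 1 < k → b (i + 1) < b i

/-- The sequence `b` without its first term. -/
def tailSeq (b : ℕ → ℕ) : ℕ → ℕ := fun i => b (i + 1)

/-- The number of `r`-sets of natural numbers that precede or equal `{b 0 > b 1 > ⋯ > b (r - 1)}`
in the colexicographic order: the sum of `C(b i, r - i)` over `i < r`, plus one. Because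
of this final one, a single sequence `b` serves for an initial segment of `k`-sets and for all its
iterated shadows: for the one that consists of `r`-sets, only the first `r` terms are used. -/
def cascade (b : ℕ → ℕ) (r : ℕ) : ℕ :=
  ∑ i ∈ range r, (b i).choose (r - i) + 1

@[simp] lemma tailSeq_apply (b : ℕ → ℕ) (i : ℕ) : tailSeq b i = b (i + 1) := rfl

@[simp] lemma cascade_zero (b : ℕ → ℕ) : cascade b 0 = 1 := by simp [cascade]

lemma cascade_succ (b : ℕ → ℕ) (r : ℕ) :
    cascade b (r + 1) = (b 0).choose (r + 1) + cascade (tailSeq b) r := by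
  unfold cascade
  rw [sum_range_succ']
  simp [tailSeq]
  omega

lemma cascade_one (b : ℕ → ℕ) : cascade b 1 = b 0 + 1 := by simp [cascade_succ]

lemma cascade_pos (b : ℕ → ℕ) (r : ℕ) : 0 < cascade b r := by unfold cascade; omega

lemma DecreasingBelow.tail {k : ℕ} {b : ℕ → ℕ} (h : DecreasingBelow (k + 1) b) :
    DecreasingBelow k (tailSeq b) := fun i hi => h (i + 1) (by omega)

lemma DecreasingBelow.mono {k l : ℕ} {b : ℕ → ℕ} (h : DecreasingBelow k b) (hl : l ≤ k) :
    DecreasingBelow l b := fun i hi => h i (by omega)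

lemma DecreasingBelow.add_le {k : ℕ} {b : ℕ → ℕ} (h : DecreasingBelow k b) {i j : ℕ}
    (hij : i ≤ j) (hj : j < k) : b j + (j - i) ≤ b i := by
  induction j, hij using Nat.le_induction with
  | base => simp
  | succ j hij ih =>
    have := ih (by omega)
    have := h j hj
    omega

lemma DecreasingBelow.le_zero {k : ℕ} {b : ℕ → ℕ} (h : DecreasingBelow k b) {j : ℕ}
    (hj : j < k) : b j + j ≤ b 0 := by
  simpa using h.add_le (Nat.zero_le j) hj

lemma DecreasingBelow.lt {k : ℕ} {b : ℕ → ℕ} (h : DecreasingBelow k b) {i j : ℕ}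
    (hij : i < j) (hj : j < k) : b j < b i := by
  have := h.add_le hij.le hj
  omega

lemma choose_lt_cascade (b : ℕ → ℕ) {r : ℕ} (hr : 0 < r) : (b 0).choose r < cascade b r := by
  obtain ⟨r, rfl⟩ := Nat.exists_eq_succ_of_ne_zero hr.ne'
  have := cascade_pos (tailSeq b) r
  rw [Nat.succ_eq_add_one, cascade_succ]
  omega

lemma cascade_le_choose {b : ℕ → ℕ} {r : ℕ} (h : DecreasingBelow r b) {M : ℕ} (hM : b 0 < M) :
    cascade b r ≤ M.choose r := by
  induction r generalizing b M with
  | zero => simp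
  | succ r ih =>
    obtain ⟨M, rfl⟩ : ∃ N, M = N + 1 := ⟨M - 1, by omega⟩
    rw [cascade_succ, Nat.choose_succ_succ, add_comm]
    refine Nat.add_le_add ?_ (Nat.choose_le_choose _ (by omega))
    rcases Nat.eq_zero_or_pos r with rfl | hr
    · simp
    · exact ih h.tail (lt_of_lt_of_le (h 0 (by omega)) (by omega))

lemma le_choose_add (k m : ℕ) : m ≤ (m + k).choose (k + 1) := by
  induction m with
  | zero => simp
  | succ m ih =>
    rw [show m + 1 + k = (m + k) + 1 by ring, Nat.choose_succ_succ]
    have : 0 < (m + k).choose k := Nat.choose_pos (by omega)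
    rw [Nat.succ_eq_add_one]
    omega

/-- The combinatorial number system: every positive integer is a cascade. -/
lemma exists_cascade_eq {k m : ℕ} (hk : 0 < k) (hm : 0 < m) :
    ∃ b, DecreasingBelow k b ∧ cascade b k = m := by
  induction k generalizing m with
  | zero => omega
  | succ k ih =>
    rcases Nat.eq_zero_or_pos k with rfl | hk
    · refine ⟨fun _ => m - 1, fun i hi => by omega, ?_⟩
      rw [cascade_one]; omega
    have hex : ∃ a, m ≤ (a + 1).choose (k + 1) :=
      ⟨m + k, (le_choose_add k m).trans (Nat.choose_le_choose _ (by omega))⟩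
    classical
    set a := Nat.find hex with ha
    have h1 : m ≤ (a + 1).choose (k + 1) := Nat.find_spec hex
    have h2 : a.choose (k + 1) < m := by
      rcases Nat.eq_zero_or_pos a with h0 | h0
      · rw [h0]; simpa using hm
      · have := Nat.find_min hex (m := a - 1) (by omega)
        rw [Nat.sub_add_cancel h0] at this
        omega
    rw [Nat.choose_succ_succ] at h1
    obtain ⟨b, hb, hbm⟩ := ih hk (m := m - a.choose (k + 1)) (by omega)
    have h3 : b 0 < a := by
      by_contra h
      have h4 := choose_lt_cascade b hk
      have := Nat.choose_le_choose k (not_lt.1 h)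
      simp only [Nat.succ_eq_add_one] at h1
      omega
    refine ⟨fun i => Nat.casesOn i a b, ?_, ?_⟩
    · intro i hi
      cases i with
      | zero => exact h3
      | succ i => exact hb i (by omega)
    · rw [cascade_succ]
      change a.choose (k + 1) + cascade b k = m
      omega

/-! ### Initial segments of the colexicographic order -/

/-- The subset `{b 0, …, b (k - 1)}` of `Fin n`. -/
def topSet (n : ℕ) (b : ℕ → ℕ) (k : ℕ) : Finset (Fin n) :=
  univ.filter fun x => ∃ i < k, b i = x

lemma mem_topSet {n : ℕ} {b : ℕ → ℕ} {k : ℕ} {x : Fin n} :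
    x ∈ topSet n b k ↔ ∃ i < k, b i = x := by simp [topSet]

lemma topSet_succ_eq_insert_tail {n : ℕ} {b : ℕ → ℕ} {k : ℕ} (hn : b 0 < n) :
    topSet n b (k + 1) = insert ⟨b 0, hn⟩ (topSet n (tailSeq b) k) := by
  ext x
  simp only [mem_topSet, mem_insert, Fin.ext_iff, tailSeq]
  constructor
  · rintro ⟨i, hi, hx⟩
    cases i with
    | zero => exact Or.inl hx.symm
    | succ i => exact Or.inr ⟨i, by omega, hx⟩
  · rintro (h | ⟨i, hi, hx⟩)
    · exact ⟨0, by omega, h.symm⟩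
    · exact ⟨i + 1, by omega, hx⟩

lemma lt_of_mem_topSet_tail {n : ℕ} {b : ℕ → ℕ} {k : ℕ} (hb : DecreasingBelow (k + 1) b)
    {x : Fin n} (hx : x ∈ topSet n (tailSeq b) k) : (x : ℕ) < b 0 := by
  obtain ⟨i, hi, hx⟩ := mem_topSet.1 hx
  rw [← hx]
  exact hb.lt (Nat.succ_pos i) (by omega)

lemma card_topSet {n : ℕ} {b : ℕ → ℕ} {k : ℕ} (hb : DecreasingBelow k b)
    (hn : 0 < k → b 0 < n) : #(topSet n b k) = k := by
  induction k generalizing b with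
  | zero => simp [topSet]
  | succ k ih =>
    rw [topSet_succ_eq_insert_tail (hn (by omega)), card_insert_of_notMem, ih hb.tail]
    · intro hk
      exact lt_trans (hb 0 (by omega)) (hn (by omega))
    · intro h
      exact absurd (lt_of_mem_topSet_tail hb h) (by simp)

/-- A set of size `k + 1` precedes `insert a s` with `s` below `a` exactly if it lies below `a`, or
contains `a` and its remaining part precedes `s`. -/
lemma initSeg_insert {n : ℕ} {a : Fin n} {s : Finset (Fin n)} (hs : ∀ x ∈ s, x < a) :
    Colex.initSeg (insert a s) =
      powersetCard (#s + 1) (Iio a) ∪ (Colex.initSeg s).image (insert a) := by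
  have has : a ∉ s := fun h => lt_irrefl _ (hs a h)
  ext t
  simp only [Colex.mem_initSeg, mem_union, mem_powersetCard, mem_image,
    card_insert_of_notMem has]
  constructor
  · rintro ⟨hc, hle⟩
    by_cases hat : a ∈ t
    · refine Or.inr ⟨t.erase a, ⟨?_, ?_⟩, insert_erase hat⟩
      · rw [card_erase_of_mem hat]; omega
      · have := (Colex.toColex_sdiff_le_toColex_sdiff (u := {a}) (s := t) (t := insert a s)
          (by simpa using hat) (by simp)).2 hle
        rwa [sdiff_singleton_eq_erase, sdiff_singleton_eq_erase, erase_insert has] at this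
    · refine Or.inl ⟨fun x hx => ?_, hc.symm⟩
      have h1 := Colex.forall_le_mono hle (a := a) (fun b hb => by
        rcases mem_insert.1 hb with rfl | hb
        · exact le_rfl
        · exact (hs b hb).le) x hx
      exact mem_Iio.2 (lt_of_le_of_ne h1 (fun h => hat (h ▸ hx)))
  · rintro (⟨hsub, hc⟩ | ⟨u, ⟨hc, hle⟩, rfl⟩)
    · refine ⟨hc.symm, ?_⟩
      refine (Colex.toColex_lt_singleton.2 fun b hb => mem_Iio.1 (hsub hb)).le.trans ?_
      exact Colex.toColex_le_toColex_of_subset (by simp)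
    · have hau : a ∉ u := fun h => lt_irrefl _ (Colex.forall_lt_mono hle hs a h)
      refine ⟨by rw [card_insert_of_notMem hau, hc], ?_⟩
      refine (Colex.toColex_sdiff_le_toColex_sdiff (u := {a}) (by simp) (by simp)).1 ?_
      rwa [sdiff_singleton_eq_erase, sdiff_singleton_eq_erase, erase_insert has,
        erase_insert hau]

lemma card_initSeg_topSet {n : ℕ} {b : ℕ → ℕ} {k : ℕ} (hb : DecreasingBelow k b)
    (hn : 0 < k → b 0 < n) : #(Colex.initSeg (topSet n b k)) = cascade b k := by
  induction k generalizing b with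
  | zero =>
    have : Colex.initSeg (topSet n b 0) = {∅} := by
      ext t
      simp only [Colex.mem_initSeg, mem_singleton, card_topSet hb hn]
      constructor
      · rintro ⟨h, -⟩; exact card_eq_zero.1 h.symm
      · rintro rfl; simp
    simp [this]
  | succ k ih =>
    have hn0 := hn (by omega)
    have hlt : ∀ x ∈ topSet n (tailSeq b) k, x < (⟨b 0, hn0⟩ : Fin n) :=
      fun x hx => Fin.lt_def.2 (lt_of_mem_topSet_tail hb hx)
    have hn' : 0 < k → tailSeq b 0 < n := fun hk => lt_trans (hb 0 (by omega)) hn0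
    rw [topSet_succ_eq_insert_tail hn0, initSeg_insert hlt, card_union_of_disjoint,
      card_powersetCard, Fin.card_Iio, card_topSet hb.tail hn', cascade_succ, card_image_of_injOn,
      ih hb.tail hn']
    · intro u hu v hv huv
      have hu' : (⟨b 0, hn0⟩ : Fin n) ∉ u := fun h =>
        lt_irrefl _ (Colex.forall_lt_mono (Colex.mem_initSeg.1 hu).2 hlt _ h)
      have hv' : (⟨b 0, hn0⟩ : Fin n) ∉ v := fun h =>
        lt_irrefl _ (Colex.forall_lt_mono (Colex.mem_initSeg.1 hv).2 hlt _ h)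
      have := congrArg (fun w => w.erase (⟨b 0, hn0⟩ : Fin n)) huv
      simpa [erase_insert hu', erase_insert hv'] using this
    · rw [disjoint_left]
      intro t ht ht'
      obtain ⟨u, -, rfl⟩ := mem_image.1 ht'
      have := mem_Iio.1 ((mem_powersetCard.1 ht).1 (mem_insert_self _ _))
      exact lt_irrefl _ this

lemma shadow_initSeg_topSet {n : ℕ} {b : ℕ → ℕ} {k : ℕ} (hb : DecreasingBelow (k + 1) b)
    (hn : b 0 < n) : ∂ (Colex.initSeg (topSet n b (k + 1))) = Colex.initSeg (topSet n b k) := by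
  have hbk : b k < n := lt_of_le_of_lt (by have := hb.le_zero (j := k) (by omega); omega) hn
  have hmem : (⟨b k, hbk⟩ : Fin n) ∈ topSet n b (k + 1) := mem_topSet.2 ⟨k, by omega, rfl⟩
  have hne : (topSet n b (k + 1)).Nonempty := ⟨_, hmem⟩
  have hmin : (topSet n b (k + 1)).min' hne = ⟨b k, hbk⟩ := by
    refine le_antisymm (min'_le _ _ hmem) (le_min' _ _ _ fun x hx => ?_)
    obtain ⟨i, hi, hx⟩ := mem_topSet.1 hx
    rw [Fin.le_def, ← hx]
    have := hb.add_le (i := i) (j := k) (by omega) (by omega)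
    simp only
    omega
  rw [Colex.shadow_initSeg hne, hmin]
  congr 1
  ext x
  simp only [mem_erase, mem_topSet, Ne, Fin.ext_iff]
  constructor
  · rintro ⟨h1, i, hi, hx⟩
    refine ⟨i, ?_, hx⟩
    rcases Nat.lt_succ_iff_lt_or_eq.1 hi with h | h
    · exact h
    · subst h; exact absurd hx.symm h1
  · rintro ⟨i, hi, hx⟩
    refine ⟨?_, i, by omega, hx⟩
    have := hb.lt hi (by omega)
    omega

lemma iterate_shadow_initSeg_topSet {n : ℕ} {b : ℕ → ℕ} {k t : ℕ} (hb : DecreasingBelow k b)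
    (hn : 0 < k → b 0 < n) (ht : t ≤ k) :
    ∂^[t] (Colex.initSeg (topSet n b k)) = Colex.initSeg (topSet n b (k - t)) := by
  induction t with
  | zero => simp
  | succ t ih =>
    rw [Function.iterate_succ_apply', ih (by omega),
      show k - t = (k - (t + 1)) + 1 by omega]
    exact shadow_initSeg_topSet (hb.mono (by omega)) (hn (by omega))

/-- A family of `k`-subsets of an `n`-set can only have size `cascade b k` if `b 0 < n`. -/
lemma lt_of_card_eq_cascade {n k : ℕ} {b : ℕ → ℕ} {S : Finset (Finset (Fin n))}
    (hS : (S : Set (Finset (Fin n))).Sized k) (hc : cascade b k ≤ #S) (hk : 0 < k) : b 0 < n := by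
  by_contra h
  have h1 := choose_lt_cascade b hk
  have h2 : #S ≤ n.choose k := by simpa using hS.card_le
  have := Nat.choose_le_choose k (not_lt.1 h)
  omega

/-- The colexicographic initial segment of `k`-sets of size `cascade b k`, and the sizes of its
iterated shadows. -/
lemma exists_isInitSeg {n k : ℕ} {b : ℕ → ℕ} (hb : DecreasingBelow k b) (hn : 0 < k → b 0 < n) :
    ∃ I : Finset (Finset (Fin n)), Colex.IsInitSeg I k ∧
      (∀ A ∈ I, ∀ x ∈ A, (x : ℕ) ≤ b 0) ∧ ∀ t ≤ k, #(∂^[t] I) = cascade b (k - t) := by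
  refine ⟨Colex.initSeg (topSet n b k), ?_, fun A hA x hx => ?_, fun t ht => ?_⟩
  · have := Colex.isInitSeg_initSeg (s := topSet n b k)
    rwa [card_topSet hb hn] at this
  · obtain ⟨hc, hle⟩ := Colex.mem_initSeg.1 hA
    have hk : 0 < k := by
      rw [card_topSet hb hn] at hc
      exact hc ▸ card_pos.2 ⟨x, hx⟩
    refine Colex.forall_le_mono hle (a := ⟨b 0, hn hk⟩) (fun y hy => ?_) x hx
    obtain ⟨i, hi, hy⟩ := mem_topSet.1 hy
    rw [Fin.le_def, ← hy]
    have := hb.le_zero hi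
    simp only
    omega
  · rw [iterate_shadow_initSeg_topSet hb hn ht, card_initSeg_topSet (hb.mono (by omega))]
    exact fun h => hn (by omega)

/-- The Kruskal–Katona theorem in terms of cascades. -/
lemma cascade_le_card_iterate_shadow {n k : ℕ} {b : ℕ → ℕ} {S : Finset (Finset (Fin n))}
    (hb : DecreasingBelow k b) (hS : (S : Set (Finset (Fin n))).Sized k)
    (hc : cascade b k ≤ #S) {t : ℕ} (ht : t ≤ k) : cascade b (k - t) ≤ #(∂^[t] S) := by
  obtain ⟨I, hI, -, hIc⟩ := exists_isInitSeg (n := n) hb fun hk => lt_of_card_eq_cascade hS hc hk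
  rw [← hIc t ht]
  refine iterated_kk hS ?_ hI
  simpa using (hIc 0 (Nat.zero_le k)).trans_le (by simpa using hc)

lemma exists_cascade_card {n k : ℕ} {S : Finset (Finset (Fin n))} (hk : 0 < k)
    (hS : S.Nonempty) : ∃ b, DecreasingBelow k b ∧ #S = cascade b k := by
  obtain ⟨b, hb, h⟩ := exists_cascade_eq hk (card_pos.2 hS)
  exact ⟨b, hb, h.symm⟩

/-- Monotonicity of the iterated-shadow bound. -/
lemma cascade_mono {k : ℕ} {b c : ℕ → ℕ} (hb : DecreasingBelow k b) (hc : DecreasingBelow k c)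
    (h : cascade b k ≤ cascade c k) {r : ℕ} (hr : r ≤ k) : cascade b r ≤ cascade c r := by
  obtain ⟨I, hI, -, hIc⟩ := exists_isInitSeg (n := c 0 + 1) hc fun _ => Nat.lt_succ_self _
  have h1 := cascade_le_card_iterate_shadow hb hI.1 (h.trans_eq (hIc 0 (Nat.zero_le k)).symm)
    (t := k - r) (by omega)
  rw [hIc _ (by omega)] at h1
  rwa [show k - (k - r) = r by omega] at h1

/-! ### Links and deletions -/

section Links

variable {α : Type*} [DecidableEq α]

lemma memberSubfamily_shadow (x : α) (S : Finset (Finset α)) :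
    (∂ S).memberSubfamily x = ∂ (S.memberSubfamily x) := by
  ext t
  simp only [mem_memberSubfamily, mem_shadow_iff_insert_mem, mem_insert, not_or]
  constructor
  · rintro ⟨⟨a, ⟨hax, hat⟩, h⟩, hx⟩
    exact ⟨a, hat, by rwa [insert_comm], fun h => hax h.symm, hx⟩
  · rintro ⟨a, hat, h, hxa, hx⟩
    exact ⟨⟨a, ⟨fun h => hxa h.symm, hat⟩, by rwa [insert_comm]⟩, hx⟩

lemma nonMemberSubfamily_shadow (x : α) (S : Finset (Finset α)) :
    (∂ S).nonMemberSubfamily x = S.memberSubfamily x ∪ ∂ (S.nonMemberSubfamily x) := by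
  ext t
  simp only [mem_nonMemberSubfamily, mem_shadow_iff_insert_mem, mem_union, mem_memberSubfamily,
    mem_insert, not_or]
  constructor
  · rintro ⟨⟨a, hat, h⟩, hx⟩
    by_cases hxa : x = a
    · subst hxa; exact Or.inl ⟨h, hx⟩
    · exact Or.inr ⟨a, hat, h, hxa, hx⟩
  · rintro (⟨h, hx⟩ | ⟨a, hat, h, hxa, hx⟩)
    · exact ⟨⟨x, hx, h⟩, hx⟩
    · exact ⟨⟨a, hat, h⟩, hx⟩

lemma memberSubfamily_iterate_shadow (x : α) (S : Finset (Finset α)) (t : ℕ) :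
    (∂^[t] S).memberSubfamily x = ∂^[t] (S.memberSubfamily x) := by
  induction t with
  | zero => rfl
  | succ t ih => rw [Function.iterate_succ_apply', Function.iterate_succ_apply',
      memberSubfamily_shadow, ih]

/-- If the link of `x` contains the shadow of the deletion of `x`, then so it is for all iterated
shadows, whose deletions of `x` are thus shadows of the link. -/
lemma nonMemberSubfamily_iterate_shadow_of_superset {x : α} {S : Finset (Finset α)}
    (h : ∂ (S.nonMemberSubfamily x) ⊆ S.memberSubfamily x) (t : ℕ) :
    (∂^[t + 1] S).nonMemberSubfamily x = ∂^[t] (S.memberSubfamily x) := by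
  induction t with
  | zero => simpa [nonMemberSubfamily_shadow] using h
  | succ t ih =>
    rw [Function.iterate_succ_apply', nonMemberSubfamily_shadow, ih,
      memberSubfamily_iterate_shadow, ← Function.iterate_succ_apply' (f := shadow), union_self]

lemma nonMemberSubfamily_iterate_shadow_of_subset {x : α} {S : Finset (Finset α)}
    (h : S.memberSubfamily x ⊆ ∂ (S.nonMemberSubfamily x)) (t : ℕ) :
    (∂^[t] S).nonMemberSubfamily x = ∂^[t] (S.nonMemberSubfamily x) := by
  induction t with
  | zero => rfl
  | succ t ih =>
    rw [Function.iterate_succ_apply', nonMemberSubfamily_shadow, ih,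
      memberSubfamily_iterate_shadow, Function.iterate_succ_apply' (f := shadow) (n := t),
      union_eq_right, ← Function.iterate_succ_apply' (f := shadow), Function.iterate_succ_apply]
    exact shadow_monotone.iterate t h

lemma card_shadow_eq_link_add (x : α) (S : Finset (Finset α)) :
    #(∂ S) = #(∂ (S.memberSubfamily x)) +
      #(S.memberSubfamily x ∪ ∂ (S.nonMemberSubfamily x)) := by
  rw [← card_memberSubfamily_add_card_nonMemberSubfamily x (∂ S), memberSubfamily_shadow,
    nonMemberSubfamily_shadow]

lemma card_iterate_shadow_of_superset {x : α} {S : Finset (Finset α)}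
    (h : ∂ (S.nonMemberSubfamily x) ⊆ S.memberSubfamily x) (t : ℕ) :
    #(∂^[t + 1] S) = #(∂^[t + 1] (S.memberSubfamily x)) + #(∂^[t] (S.memberSubfamily x)) := by
  rw [← card_memberSubfamily_add_card_nonMemberSubfamily x (∂^[t + 1] S),
    memberSubfamily_iterate_shadow, nonMemberSubfamily_iterate_shadow_of_superset h]

lemma card_iterate_shadow_of_subset {x : α} {S : Finset (Finset α)}
    (h : S.memberSubfamily x ⊆ ∂ (S.nonMemberSubfamily x)) (t : ℕ) :
    #(∂^[t] S) = #(∂^[t] (S.memberSubfamily x)) + #(∂^[t] (S.nonMemberSubfamily x)) := by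
  rw [← card_memberSubfamily_add_card_nonMemberSubfamily x (∂^[t] S),
    memberSubfamily_iterate_shadow, nonMemberSubfamily_iterate_shadow_of_subset h]

lemma sized_memberSubfamily {x : α} {S : Finset (Finset α)} {k : ℕ}
    (h : (S : Set (Finset α)).Sized (k + 1)) :
    (S.memberSubfamily x : Set (Finset α)).Sized k := by
  intro t ht
  obtain ⟨h1, h2⟩ := mem_memberSubfamily.1 (mem_coe.1 ht)
  have := h (mem_coe.2 h1)
  rw [card_insert_of_notMem h2] at this
  omega

lemma sized_nonMemberSubfamily {x : α} {S : Finset (Finset α)} {k : ℕ}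
    (h : (S : Set (Finset α)).Sized k) : (S.nonMemberSubfamily x : Set (Finset α)).Sized k :=
  fun _ ht => h (mem_coe.2 (mem_nonMemberSubfamily.1 (mem_coe.1 ht)).1)

/-- The family with link `I` and deletion `J` at the vertex `x`. -/
def glue (x : α) (I J : Finset (Finset α)) : Finset (Finset α) := J ∪ I.image (insert x)

lemma memberSubfamily_glue {x : α} {I J : Finset (Finset α)} (hI : ∀ A ∈ I, x ∉ A)
    (hJ : ∀ A ∈ J, x ∉ A) : (glue x I J).memberSubfamily x = I := by
  rw [glue, memberSubfamily_union, memberSubfamily_image_insert hI, union_eq_right]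
  intro t ht
  exact absurd (mem_insert_self _ _) (hJ _ (mem_memberSubfamily.1 ht).1)

lemma nonMemberSubfamily_glue {x : α} {I J : Finset (Finset α)}
    (hJ : ∀ A ∈ J, x ∉ A) : (glue x I J).nonMemberSubfamily x = J := by
  rw [glue, nonMemberSubfamily_union, nonMemberSubfamily_image_insert, union_empty]
  ext t
  simp only [mem_nonMemberSubfamily, and_iff_left_iff_imp]
  exact hJ t

lemma sized_glue {x : α} {I J : Finset (Finset α)} {k : ℕ} (hI : ∀ A ∈ I, x ∉ A)
    (hIk : (I : Set (Finset α)).Sized k) (hJk : (J : Set (Finset α)).Sized (k + 1)) :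
    (glue x I J : Set (Finset α)).Sized (k + 1) := by
  intro t ht
  rcases mem_union.1 (mem_coe.1 ht) with h | h
  · exact hJk (mem_coe.2 h)
  · obtain ⟨u, hu, rfl⟩ := mem_image.1 h
    rw [card_insert_of_notMem (hI u hu), hIk (mem_coe.2 hu)]

end Links

/-! ### Extremal families -/

/-- `S` is a family of `k`-sets of size `cascade b k` attaining the Kruskal–Katona bound for the
shadow. The sequence `b` is part of the data, since it governs the sizes of all iterated shadows. -/
structure Extremal {n : ℕ} (k : ℕ) (b : ℕ → ℕ) (S : Finset (Finset (Fin n))) : Prop where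
  decreasing : DecreasingBelow k b
  sized : (S : Set (Finset (Fin n))).Sized k
  card_eq : #S = cascade b k
  card_shadow : #(∂ S) = cascade b (k - 1)

lemma Extremal.nonempty {n k : ℕ} {b : ℕ → ℕ} {S : Finset (Finset (Fin n))}
    (h : Extremal k b S) : S.Nonempty := by
  rw [← card_pos, h.card_eq]; exact cascade_pos _ _

/-- Every family of `k`-sets on `Fin n` has a colexicographic initial segment of the same size,
realised on `Fin (n + 1)` without using the last vertex. -/
lemma exists_colex_model {n k : ℕ} (hk : 0 < k) {S : Finset (Finset (Fin n))}
    (hS : (S : Set (Finset (Fin n))).Sized k) :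
    ∃ I : Finset (Finset (Fin (n + 1))), Colex.IsInitSeg I k ∧ (∀ A ∈ I, Fin.last n ∉ A) ∧
      #I = #S ∧ #(∂ I) ≤ #(∂ S) ∧
      (S.Nonempty → ∃ b, DecreasingBelow k b ∧ #S = cascade b k ∧
        ∀ t ≤ k, #(∂^[t] I) = cascade b (k - t)) := by
  rcases S.eq_empty_or_nonempty with rfl | hne
  · exact ⟨∅, by simp, by simp, by simp, by simp, by simp⟩
  obtain ⟨b, hb, hc⟩ := exists_cascade_card hk hne
  have hbn : b 0 < n := lt_of_card_eq_cascade hS hc.ge hk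
  obtain ⟨I, hI, hIb, hIc⟩ := exists_isInitSeg (n := n + 1) hb fun _ => by omega
  have hcard : #I = #S := by simpa [hc] using hIc 0 (Nat.zero_le k)
  refine ⟨I, hI, fun A hA h => ?_, hcard, ?_, fun _ => ⟨b, hb, hc, hIc⟩⟩
  · have := hIb A hA _ h
    simp at this
    omega
  · have h1 := hIc 1 hk
    have h2 := cascade_le_card_iterate_shadow hb hS hc.ge (t := 1) hk
    simp only [Function.iterate_one] at h1 h2
    omega

lemma shadow_subset_or_subset {n k : ℕ} {I J : Finset (Finset (Fin n))}
    (hI : Colex.IsInitSeg I k) (hJ : Colex.IsInitSeg J (k + 1)) : ∂ J ⊆ I ∨ I ⊆ ∂ J :=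
  Colex.IsInitSeg.total hJ.shadow hI

/-- The equality case in the inductive step of Kruskal–Katona at a vertex `x`: the link of `x` is
extremal, and either it contains the shadow of the deletion of `x`, or it is contained in it and
the deletion is extremal as well. -/
lemma Extremal.link {n k : ℕ} (hk : 0 < k) {b : ℕ → ℕ} {S : Finset (Finset (Fin n))}
    (h : Extremal (k + 1) b S) {x : Fin n} (hx : (S.memberSubfamily x).Nonempty) :
    (∃ c, Extremal k c (S.memberSubfamily x)) ∧
      (∂ (S.nonMemberSubfamily x) ⊆ S.memberSubfamily x ∨
        (S.memberSubfamily x ⊆ ∂ (S.nonMemberSubfamily x) ∧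
          ∃ d, Extremal (k + 1) d (S.nonMemberSubfamily x))) := by
  have hs1 := sized_memberSubfamily (x := x) h.sized
  have hs0 := sized_nonMemberSubfamily (x := x) h.sized
  obtain ⟨I, hI, hIl, hIc, hIs, hIb⟩ := exists_colex_model hk hs1
  obtain ⟨J, hJ, hJl, hJc, hJs, hJb⟩ := exists_colex_model (k := k + 1) (by omega) hs0
  have hcard := card_memberSubfamily_add_card_nonMemberSubfamily x S
  have hcard' := card_memberSubfamily_add_card_nonMemberSubfamily (Fin.last n)
    (glue (Fin.last n) I J)
  have hsh := card_shadow_eq_link_add x S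
  have hsh' := card_shadow_eq_link_add (Fin.last n) (glue (Fin.last n) I J)
  rw [memberSubfamily_glue hIl hJl, nonMemberSubfamily_glue hJl] at hcard' hsh'
  have hkk := cascade_le_card_iterate_shadow h.decreasing
    (sized_glue (k := k) hIl hI.1 hJ.1) (by rw [← h.card_eq]; omega) (t := 1) (by omega)
  have h1 := h.card_shadow
  rw [Function.iterate_one] at hkk
  have hu1 : #(S.memberSubfamily x) ≤ #(S.memberSubfamily x ∪ ∂ (S.nonMemberSubfamily x)) :=
    card_le_card subset_union_left
  have hu2 : #(∂ (S.nonMemberSubfamily x)) ≤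
      #(S.memberSubfamily x ∪ ∂ (S.nonMemberSubfamily x)) := card_le_card subset_union_right
  have hext : #(∂ I) = #(∂ (S.memberSubfamily x)) →
      ∃ c, Extremal k c (S.memberSubfamily x) := by
    intro he
    obtain ⟨c, hc, hcc, hct⟩ := hIb hx
    exact ⟨c, hc, hs1, hcc, by rw [← he]; simpa using hct 1 hk⟩
  have hne0 : (∂ J).Nonempty → (S.nonMemberSubfamily x).Nonempty := by
    intro hne
    rw [← card_pos, ← hJc, card_pos]
    by_contra he
    rw [not_nonempty_iff_eq_empty.1 he] at hne
    simp at hne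
  rcases shadow_subset_or_subset hI hJ with hsub | hsub
  · rw [union_eq_left.2 hsub] at hsh'
    refine ⟨hext (by omega), Or.inl ?_⟩
    have : S.memberSubfamily x = S.memberSubfamily x ∪ ∂ (S.nonMemberSubfamily x) :=
      eq_of_subset_of_card_le subset_union_left (by omega)
    exact union_eq_left.1 this.symm
  · rw [union_eq_right.2 hsub] at hsh'
    refine ⟨hext (by omega), Or.inr ⟨?_, ?_⟩⟩
    · have : ∂ (S.nonMemberSubfamily x) = S.memberSubfamily x ∪ ∂ (S.nonMemberSubfamily x) :=
        eq_of_subset_of_card_le subset_union_right (by omega)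
      exact union_eq_right.1 this.symm
    · have hne : (S.nonMemberSubfamily x).Nonempty := by
        refine hne0 (Nonempty.mono hsub ?_)
        rw [← card_pos, hIc, card_pos]; exact hx
      obtain ⟨d, hd, hdc, hdt⟩ := hJb hne
      refine ⟨d, hd, hs0, hdc, ?_⟩
      have := hdt 1 (by omega)
      rw [Function.iterate_one] at this
      omega

lemma card_iterate_shadow_self {n k : ℕ} (hk : 0 < k) {S : Finset (Finset (Fin n))}
    (hS : (S : Set (Finset (Fin n))).Sized k) (hne : S.Nonempty) : #(∂^[k] S) = 1 := by
  obtain ⟨b, hb, hc⟩ := exists_cascade_card hk hne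
  have h1 := cascade_le_card_iterate_shadow hb hS hc.ge le_rfl
  have h2 := (hS.shadow_iterate (k := k)).card_le
  simp only [Nat.sub_self, cascade_zero, Nat.choose_zero_right] at h1 h2
  omega

/-- A colexicographic initial segment dominates at the least vertex. -/
lemma shadow_nonMemberSubfamily_zero_subset {n k : ℕ} {I : Finset (Finset (Fin (n + 1)))}
    (hI : Colex.IsInitSeg I k) :
    ∂ (I.nonMemberSubfamily 0) ⊆ I.memberSubfamily 0 := by
  intro t ht
  obtain ⟨a, hat, ha⟩ := mem_shadow_iff_insert_mem.1 ht
  obtain ⟨haI, h0⟩ := mem_nonMemberSubfamily.1 ha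
  rw [mem_insert, not_or] at h0
  refine mem_memberSubfamily.2 ⟨hI.2 haI ⟨?_, ?_⟩, h0.2⟩
  · rw [Colex.insert_lt_insert h0.2 hat]
    exact Fin.pos_iff_ne_zero.2 fun h => h0.1 h.symm
  · rw [card_insert_of_notMem h0.2, ← hI.1 (mem_coe.2 haI), card_insert_of_notMem hat]

lemma memberSubfamily_nonempty_of_shadow_subset {n k : ℕ} {S : Finset (Finset (Fin n))}
    {x : Fin n} (hS : (S : Set (Finset (Fin n))).Sized (k + 1)) (hne : S.Nonempty)
    (h : ∂ (S.nonMemberSubfamily x) ⊆ S.memberSubfamily x) :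
    (S.memberSubfamily x).Nonempty := by
  obtain ⟨A, hA⟩ := hne
  by_cases hx : x ∈ A
  · exact ⟨A.erase x, mem_memberSubfamily.2 ⟨by rwa [insert_erase hx], notMem_erase _ _⟩⟩
  · obtain ⟨y, hy⟩ : A.Nonempty := card_pos.1 (by rw [hS (mem_coe.2 hA)]; omega)
    exact ⟨_, h (erase_mem_shadow (mem_nonMemberSubfamily.2 ⟨hA, hx⟩) hy)⟩

/-- If the link of some vertex contains the shadow of its deletion, the sizes of all iterated
shadows of an extremal family are determined: `h + |∂ I(h)|` is strictly increasing in the size `h`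
of the link, so `h` agrees with the corresponding number for a colexicographic segment. -/
lemma Extremal.card_iterate_shadow_of_superset {n k : ℕ} (hk : 0 < k)
    (ih : ∀ (n : ℕ) (b : ℕ → ℕ) (S : Finset (Finset (Fin n))), Extremal k b S →
      ∀ t ≤ k, #(∂^[t] S) = cascade b (k - t))
    {b : ℕ → ℕ} {S : Finset (Finset (Fin n))} (h : Extremal (k + 1) b S) {x : Fin n}
    (hx : ∂ (S.nonMemberSubfamily x) ⊆ S.memberSubfamily x) {t : ℕ} (ht : t ≤ k + 1) :
    #(∂^[t] S) = cascade b (k + 1 - t) := by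
  obtain ⟨I, hI, -, hIc⟩ := exists_isInitSeg (n := n + 1) h.decreasing fun _ =>
    (lt_of_card_eq_cascade h.sized h.card_eq.ge (by omega)).trans (Nat.lt_succ_self _)
  have hI0 := shadow_nonMemberSubfamily_zero_subset hI
  have hIe : Extremal (k + 1) b I :=
    ⟨h.decreasing, hI.1, by simpa using hIc 0 (by omega), by simpa using hIc 1 (by omega)⟩
  obtain ⟨⟨c, hc⟩, -⟩ := h.link hk (memberSubfamily_nonempty_of_shadow_subset h.sized h.nonempty hx)
  obtain ⟨⟨d, hd⟩, -⟩ :=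
    hIe.link hk (memberSubfamily_nonempty_of_shadow_subset hIe.sized hIe.nonempty hI0)
  have hS := fun t => _root_.card_iterate_shadow_of_superset hx t
  have hT := fun t => _root_.card_iterate_shadow_of_superset hI0 t
  have e1 := hS 0
  have e2 := hT 0
  simp only [zero_add, Function.iterate_one, Function.iterate_zero, id_eq] at e1 e2
  rw [h.card_shadow, hc.card_shadow, hc.card_eq] at e1
  rw [hIe.card_shadow, hd.card_shadow, hd.card_eq] at e2
  have hcd : cascade c k = cascade d k := by
    rcases le_total (cascade c k) (cascade d k) with hle | hle
    · have := cascade_mono hc.decreasing hd.decreasing hle (r := k - 1) (by omega)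
      omega
    · have := cascade_mono hd.decreasing hc.decreasing hle (r := k - 1) (by omega)
      omega
  have hcd' : ∀ r ≤ k, cascade c r = cascade d r := fun r hr =>
    le_antisymm (cascade_mono hc.decreasing hd.decreasing hcd.le hr)
      (cascade_mono hd.decreasing hc.decreasing hcd.ge hr)
  rcases Nat.eq_zero_or_pos t with rfl | ht0
  · simpa using h.card_eq
  obtain ⟨t, rfl⟩ : ∃ s, t = s + 1 := ⟨t - 1, by omega⟩
  rcases Nat.lt_or_ge t k with htk | htk
  · rw [← hIc _ ht, hS, hT, ih _ _ _ hc _ htk, ih _ _ _ hd _ htk, ih _ _ _ hc _ htk.le,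
      ih _ _ _ hd _ htk.le, hcd' _ (by omega), hcd' _ (by omega)]
  · obtain rfl : t = k := by omega
    rw [card_iterate_shadow_self (by omega) h.sized h.nonempty]
    simp

/-- **Iterated extremality**: if a family attains the Kruskal–Katona bound for its shadow, then it
attains it for all iterated shadows. -/
theorem Extremal.card_iterate_shadow {n k : ℕ} (hk : 0 < k) {b : ℕ → ℕ}
    {S : Finset (Finset (Fin n))} (h : Extremal k b S) {t : ℕ} (ht : t ≤ k) :
    #(∂^[t] S) = cascade b (k - t) := by
  induction k generalizing n b S t with
  | zero => omega
  | succ k ih =>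
  rcases Nat.eq_zero_or_pos k with rfl | hk'
  · rcases Nat.eq_zero_or_pos t with rfl | ht0
    · simpa using h.card_eq
    · obtain rfl : t = 1 := by omega
      simpa using h.card_shadow
  replace ih : ∀ (n : ℕ) (b : ℕ → ℕ) (S : Finset (Finset (Fin n))), Extremal k b S →
      ∀ t ≤ k, #(∂^[t] S) = cascade b (k - t) := fun n b S hS t ht => ih hk' hS ht
  induction hm : #S using Nat.strong_induction_on generalizing n b S t with
  | _ m ihm =>
  subst hm
  obtain ⟨A, hA⟩ := h.nonempty
  obtain ⟨x, hxA⟩ : A.Nonempty := card_pos.1 (by rw [h.sized (mem_coe.2 hA)]; omega)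
  have hx : (S.memberSubfamily x).Nonempty :=
    ⟨A.erase x, mem_memberSubfamily.2 ⟨by rwa [insert_erase hxA], notMem_erase _ _⟩⟩
  obtain ⟨⟨c, hc⟩, hsub | ⟨hsub, d, hd⟩⟩ := h.link hk' hx
  · exact h.card_iterate_shadow_of_superset hk' ih hsub ht
  -- Replace link and deletion by colexicographic segments; the resulting family has the same
  -- iterated shadow sizes and dominates at its least vertex.
  have hcard := card_memberSubfamily_add_card_nonMemberSubfamily x S
  have hlt : #(S.nonMemberSubfamily x) < #S := by
    have := card_pos.2 hx
    omega
  have hd' : ∀ t ≤ k + 1, #(∂^[t] (S.nonMemberSubfamily x)) = cascade d (k + 1 - t) :=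
    fun t ht => ihm _ hlt hd ht rfl
  have hcn := lt_of_card_eq_cascade hc.sized hc.card_eq.ge hk'
  have hdn := lt_of_card_eq_cascade hd.sized hd.card_eq.ge (Nat.succ_pos k)
  obtain ⟨I, hI, hIb, hIc⟩ := exists_isInitSeg (n := n + 1) hc.decreasing fun _ => by omega
  obtain ⟨J, hJ, hJb, hJc⟩ := exists_isInitSeg (n := n + 1) hd.decreasing fun _ => by omega
  have hIl : ∀ A ∈ I, Fin.last n ∉ A := fun A hA h => by
    have := hIb A hA _ h
    simp at this
    omega
  have hJl : ∀ A ∈ J, Fin.last n ∉ A := fun A hA h => by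
    have := hJb A hA _ h
    simp at this
    omega
  have hIJ : I ⊆ ∂ J := by
    rcases shadow_subset_or_subset hI hJ with h1 | h1
    · refine (eq_of_subset_of_card_le h1 ?_).ge
      have e1 := hIc 0 (by omega)
      have e2 := hJc 1 (by omega)
      have e3 := card_le_card hsub
      rw [hc.card_eq, hd.card_shadow] at e3
      simp only [Function.iterate_one, Function.iterate_zero, id_eq, Nat.sub_zero] at e1 e2
      rw [e1, e2]
      exact e3
    · exact h1
  set T := glue (Fin.last n) I J with hT
  have hTm : T.memberSubfamily (Fin.last n) = I := memberSubfamily_glue hIl hJl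
  have hTn : T.nonMemberSubfamily (Fin.last n) = J := nonMemberSubfamily_glue hJl
  have hTs : T.memberSubfamily (Fin.last n) ⊆ ∂ (T.nonMemberSubfamily (Fin.last n)) := by
    rwa [hTm, hTn]
  have hST : ∀ t ≤ k, #(∂^[t] S) = #(∂^[t] T) := fun t ht => by
    rw [card_iterate_shadow_of_subset hsub, card_iterate_shadow_of_subset hTs, hTm, hTn,
      hIc t ht, hJc t (by omega), ih _ _ _ hc t ht, hd' t (by omega)]
  have hTe : Extremal (k + 1) b T := by
    refine ⟨h.decreasing, sized_glue hIl hI.1 hJ.1, ?_, ?_⟩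
    · rw [← h.card_eq]; exact (hST 0 (by omega)).symm
    · rw [← h.card_shadow]; exact (hST 1 (by omega)).symm
  have hn : (0 : Fin (n + 1)) ≠ Fin.last n := by
    rw [Ne, Fin.ext_iff, Fin.val_zero, Fin.val_last]
    exact fun h0 => by have := x.2; omega
  have hT0 : ∂ (T.nonMemberSubfamily 0) ⊆ T.memberSubfamily 0 := by
    intro t ht
    obtain ⟨a, hat, ha⟩ := mem_shadow_iff_insert_mem.1 ht
    obtain ⟨haT, h0⟩ := mem_nonMemberSubfamily.1 ha
    rw [mem_insert, not_or] at h0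
    refine mem_memberSubfamily.2 ⟨?_, h0.2⟩
    have hcase : insert a t ∈ J → insert 0 t ∈ J := fun hmem =>
      (mem_memberSubfamily.1 (shadow_nonMemberSubfamily_zero_subset hJ
        (mem_shadow_iff_insert_mem.2 ⟨a, hat, mem_nonMemberSubfamily.2
          ⟨hmem, by simp [h0.1, h0.2]⟩⟩))).1
    rcases mem_union.1 haT with hmem | hmem
    · exact mem_union_left _ (hcase hmem)
    obtain ⟨u, hu, hut⟩ := mem_image.1 hmem
    by_cases hal : a = Fin.last n
    · -- Use that the link of the last vertex lies in the shadow of its deletion.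
      have hlt : Fin.last n ∉ t := hal ▸ hat
      have : u = t := by
        have := congrArg (fun w => w.erase (Fin.last n)) hut
        rwa [hal, erase_insert (hIl u hu), erase_insert hlt] at this
      subst this
      obtain ⟨w, hw, hwJ⟩ := mem_shadow_iff_insert_mem.1 (hIJ hu)
      by_cases hw0 : w = 0
      · subst hw0; exact mem_union_left _ hwJ
      · refine mem_union_left _ (mem_memberSubfamily.1 (shadow_nonMemberSubfamily_zero_subset hJ
          (mem_shadow_iff_insert_mem.2 ⟨w, hw, mem_nonMemberSubfamily.2
          ⟨hwJ, ?_⟩⟩))).1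
        rw [mem_insert, not_or]
        exact ⟨fun h => hw0 h.symm, h0.2⟩
    · have hlt : Fin.last n ∈ t := by
        have : Fin.last n ∈ insert a t := hut ▸ mem_insert_self _ _
        rcases mem_insert.1 this with h | h
        · exact absurd h.symm hal
        · exact h
      have hu' : u = insert a (t.erase (Fin.last n)) := by
        have := congrArg (fun w => w.erase (Fin.last n)) hut
        rw [erase_insert (hIl u hu), erase_insert_of_ne hal] at this
        exact this
      have hz : insert 0 (t.erase (Fin.last n)) ∈ I := by
        refine (mem_memberSubfamily.1 (shadow_nonMemberSubfamily_zero_subset hI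
          (mem_shadow_iff_insert_mem.2 ⟨a, fun h => hat (mem_of_mem_erase h),
            mem_nonMemberSubfamily.2 ⟨hu' ▸ hu, ?_⟩⟩))).1
        rw [mem_insert, not_or]
        exact ⟨h0.1, fun h => h0.2 (mem_of_mem_erase h)⟩
      refine mem_union_right _ (mem_image.2 ⟨_, hz, ?_⟩)
      rw [insert_comm, insert_erase hlt]
  rcases Nat.lt_or_ge k t with htk | htk
  · obtain rfl : t = k + 1 := by omega
    rw [card_iterate_shadow_self (by omega) h.sized h.nonempty]
    simp
  · rw [hST t htk]
    exact hTe.card_iterate_shadow_of_superset hk' ih hT0 ht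

/-! ### Generating polynomials -/

section Polynomials

open Polynomial

/-- The polynomial `1 + X`. -/
noncomputable def onePlusX : ℤ[X] := 1 + X

/-- The polynomial `((1 + X)^m - 1) / X`. -/
noncomputable def geomPoly (m : ℕ) : ℤ[X] := ∑ l ∈ range m, onePlusX ^ l

/-- The polynomial `∑ i < n, X ^ i * (1 + X) ^ b i + X ^ n`, whose coefficient at `X ^ r` is
`cascade b r` for all `r ≤ n`. -/
noncomputable def cascadePoly : ℕ → (ℕ → ℕ) → ℤ[X]
  | 0, _ => 1
  | n + 1, b => onePlusX ^ b 0 + X * cascadePoly n (tailSeq b)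

/-- All coefficients are nonnegative. -/
def NonnegCoeff (p : ℤ[X]) : Prop := ∀ i, 0 ≤ p.coeff i

lemma coeff_onePlusX_pow (m r : ℕ) : (onePlusX ^ m).coeff r = (m.choose r : ℤ) := by
  rw [onePlusX, coeff_one_add_X_pow]

lemma coeff_cascadePoly {n r : ℕ} (b : ℕ → ℕ) (hr : r ≤ n) :
    (cascadePoly n b).coeff r = (cascade b r : ℤ) := by
  induction n generalizing b r with
  | zero =>
    obtain rfl : r = 0 := by omega
    simp [cascadePoly]
  | succ n ih =>
    cases r with
    | zero => simp [cascadePoly, coeff_onePlusX_pow]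
    | succ r =>
      rw [cascadePoly, coeff_add, coeff_X_mul, ih _ (by omega), coeff_onePlusX_pow, cascade_succ]
      push_cast; ring

lemma X_mul_geomPoly (m : ℕ) : X * geomPoly m = onePlusX ^ m - 1 := by
  have := geom_sum_mul onePlusX m
  rw [← this, geomPoly, onePlusX]
  ring

lemma NonnegCoeff.add {p q : ℤ[X]} (hp : NonnegCoeff p) (hq : NonnegCoeff q) :
    NonnegCoeff (p + q) := fun i => by rw [coeff_add]; exact add_nonneg (hp i) (hq i)

lemma NonnegCoeff.mul {p q : ℤ[X]} (hp : NonnegCoeff p) (hq : NonnegCoeff q) :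
    NonnegCoeff (p * q) := fun i => by
  rw [coeff_mul]; exact sum_nonneg fun _ _ => mul_nonneg (hp _) (hq _)

lemma NonnegCoeff.sum {s : Finset ℕ} {f : ℕ → ℤ[X]} (h : ∀ i ∈ s, NonnegCoeff (f i)) :
    NonnegCoeff (∑ i ∈ s, f i) := fun j => by
  rw [finsetSum_coeff]; exact sum_nonneg fun i hi => h i hi j

lemma nonnegCoeff_onePlusX_pow (m : ℕ) : NonnegCoeff (onePlusX ^ m) := fun i => by
  rw [coeff_onePlusX_pow]; positivity

lemma nonnegCoeff_geomPoly (m : ℕ) : NonnegCoeff (geomPoly m) :=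
  NonnegCoeff.sum fun l _ => nonnegCoeff_onePlusX_pow l

lemma NonnegCoeff.divX {p : ℤ[X]} (hp : NonnegCoeff p) : NonnegCoeff (divX p) := fun i => by
  rw [coeff_divX]; exact hp _

lemma coeff_zero_geomPoly (m : ℕ) : (geomPoly m).coeff 0 = m := by
  simp [geomPoly, coeff_onePlusX_pow]

lemma coeff_one_geomPoly (m : ℕ) : (geomPoly m).coeff 1 = ((∑ l ∈ range m, l : ℕ) : ℤ) := by
  simp [geomPoly, coeff_onePlusX_pow]

/-- `((Σ_{l < e} ((1 + X)^(e + 1) - (1 + X)^l)) / X`, with nonnegative coefficients. -/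
noncomputable def spreadPoly (e : ℕ) : ℤ[X] :=
  ∑ l ∈ range e, onePlusX ^ l * geomPoly (e + 1 - l)

lemma nonnegCoeff_spreadPoly (e : ℕ) : NonnegCoeff (spreadPoly e) :=
  NonnegCoeff.sum fun _ _ => (nonnegCoeff_onePlusX_pow _).mul (nonnegCoeff_geomPoly _)

lemma X_sq_mul_spreadPoly (e : ℕ) :
    X ^ 2 * spreadPoly e = X * (e : ℤ[X]) * onePlusX ^ (e + 1) - (onePlusX ^ e - 1) := by
  have h : X * spreadPoly e = (e : ℤ[X]) * onePlusX ^ (e + 1) - geomPoly e := by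
    rw [spreadPoly, mul_sum, geomPoly]
    have : ∀ l ∈ range e, X * (onePlusX ^ l * geomPoly (e + 1 - l)) =
        onePlusX ^ (e + 1) - onePlusX ^ l := by
      intro l hl
      have hl' := mem_range.1 hl
      rw [mul_left_comm, X_mul_geomPoly, mul_sub, ← pow_add, mul_one]
      congr 2
      omega
    rw [sum_congr rfl this, sum_sub_distrib]
    simp
  rw [pow_two, mul_assoc, h, mul_sub, X_mul_geomPoly]
  ring

lemma two_mul_coeff_zero_spreadPoly (e : ℕ) :
    2 * (spreadPoly e).coeff 0 = (e : ℤ) ^ 2 + 3 * e := by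
  have h1 : (spreadPoly e).coeff 0 = ((∑ l ∈ range e, (e + 1 - l) : ℕ) : ℤ) := by
    simp [spreadPoly, mul_coeff_zero, coeff_onePlusX_pow, coeff_zero_geomPoly]
  have h2 : ∑ l ∈ range e, (e + 1 - l) = ∑ l ∈ range e, (l + 2) := by
    rw [← sum_range_reflect]
    refine sum_congr rfl fun l hl => ?_
    have := mem_range.1 hl
    omega
  rw [h1, h2, sum_add_distrib]
  have h3 := Finset.sum_range_id_mul_two e
  rcases Nat.eq_zero_or_pos e with rfl | he
  · simp
  have h4 : ((e - 1 : ℕ) : ℤ) = e - 1 := by push_cast [he]; ring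
  zify at h3
  rw [h4] at h3
  push_cast
  simp only [sum_const, card_range, nsmul_eq_mul]
  linarith

lemma coeff_one_spreadPoly (e : ℕ) : (spreadPoly e).coeff 1 =
    ((∑ l ∈ range e, ((∑ i ∈ range (e + 1 - l), i) + l * (e + 1 - l)) : ℕ) : ℤ) := by
  rw [spreadPoly, finsetSum_coeff]
  push_cast
  refine sum_congr rfl fun l hl => ?_
  have hl' := mem_range.1 hl
  rw [mul_coeff_one, coeff_one_geomPoly, coeff_zero_geomPoly, coeff_onePlusX_pow,
    coeff_onePlusX_pow]
  simp

lemma one_le_coeff_one_spreadPoly {e : ℕ} (he : 1 ≤ e) : 1 ≤ (spreadPoly e).coeff 1 := by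
  rw [coeff_one_spreadPoly]
  have h1 := sum_le_sum_of_subset (f := fun l => (∑ i ∈ range (e + 1 - l), i) + l * (e + 1 - l))
    (range_mono he)
  have h2 := sum_le_sum_of_subset (f := fun l => l) (range_mono (show 2 ≤ e + 1 by omega))
  simp [sum_range_succ] at h1 h2
  exact_mod_cast h2.trans h1

lemma six_le_coeff_one_spreadPoly {e : ℕ} (he : 2 ≤ e) : 6 ≤ (spreadPoly e).coeff 1 := by
  rw [coeff_one_spreadPoly]
  have h1 := sum_le_sum_of_subset (f := fun l => (∑ i ∈ range (e + 1 - l), i) + l * (e + 1 - l))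
    (range_mono he)
  have h2 := sum_le_sum_of_subset (f := fun l => l) (range_mono (show 3 ≤ e + 1 by omega))
  have h3 := sum_le_sum_of_subset (f := fun l => l) (range_mono he)
  rw [sum_range_succ, sum_range_one] at h1
  simp only [Nat.sub_zero, zero_mul, add_zero, Nat.add_sub_cancel, one_mul] at h1
  rw [show ∑ i ∈ range 3, i = 3 from rfl] at h2
  rw [show ∑ i ∈ range 2, i = 1 from rfl] at h3
  have : 6 ≤ ∑ l ∈ range e, ((∑ i ∈ range (e + 1 - l), i) + l * (e + 1 - l)) := by omega
  exact_mod_cast this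

lemma coeff_one_le_onePlusX_pow_mul {p : ℤ[X]} (hp : NonnegCoeff p) (m : ℕ) :
    p.coeff 1 ≤ (onePlusX ^ m * p).coeff 1 := by
  rw [mul_coeff_one, coeff_onePlusX_pow, coeff_onePlusX_pow]
  simp only [Nat.choose_zero_right, Nat.choose_one_right, Nat.cast_one, one_mul]
  have := mul_nonneg (Int.natCast_nonneg m) (hp 0)
  linarith

/-! ### Doubly exponential growth of gaps -/

/-- The number of integers strictly between the first two terms of a decreasing sequence. -/
def gap (b : ℕ → ℕ) : ℕ := b 0 - b 1 - 1

/-- A relation between three decreasing sequences: up to degree `n`, the generating polynomials of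
the defects `C(b 0 + 1, r) - cascade b r` satisfy
`defect b = defect c + defect d + (1 + X) ^ (b 0 + 1) * X ^ 2 * w`,
where `w` has nonnegative coefficients, `c 0 = b 0 + u` and `d 0 = b 0 + v`. -/
structure DefectRelation (n : ℕ) (b c d : ℕ → ℕ) (w : ℤ[X]) (u v : ℕ) : Prop where
  nonneg : NonnegCoeff w
  fst : c 0 = b 0 + u
  snd : d 0 = b 0 + v
  dvd : X ^ (n + 1) ∣ cascadePoly n b +
    onePlusX ^ (b 0 + 1) * (X ^ 2 * w + onePlusX ^ u + onePlusX ^ v - 1) -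
    cascadePoly n c - cascadePoly n d

/-- The polynomial `w` of the `DefectRelation` for the tails of the three sequences, where `B` and
`Z` are the gaps of `c` and `d`. -/
noncomputable def nextPoly (B Z e u v : ℕ) (w : ℤ[X]) : ℤ[X] :=
  onePlusX ^ (B + Z) * (onePlusX ^ (e + 1) * divX w + spreadPoly e) +
    onePlusX ^ Z * geomPoly (u + e) * geomPoly B + geomPoly (v + B + e) * geomPoly Z

lemma nonnegCoeff_nextPoly (B Z e u v : ℕ) {w : ℤ[X]} (hw : NonnegCoeff w) :
    NonnegCoeff (nextPoly B Z e u v w) := by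
  unfold nextPoly
  refine NonnegCoeff.add (NonnegCoeff.add (NonnegCoeff.mul (nonnegCoeff_onePlusX_pow _)
    (NonnegCoeff.add (NonnegCoeff.mul (nonnegCoeff_onePlusX_pow _) hw.divX)
      (nonnegCoeff_spreadPoly _))) ?_) ?_
  · exact NonnegCoeff.mul (NonnegCoeff.mul (nonnegCoeff_onePlusX_pow _) (nonnegCoeff_geomPoly _))
      (nonnegCoeff_geomPoly _)
  · exact NonnegCoeff.mul (nonnegCoeff_geomPoly _) (nonnegCoeff_geomPoly _)

lemma coeff_zero_nextPoly (B Z e u v : ℕ) (w : ℤ[X]) :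
    (nextPoly B Z e u v w).coeff 0 =
      w.coeff 1 + (spreadPoly e).coeff 0 + (u + e) * B + (v + B + e) * Z := by
  simp [nextPoly, mul_coeff_zero, coeff_onePlusX_pow, coeff_zero_geomPoly, coeff_divX]

lemma coeff_one_spreadPoly_le_nextPoly (B Z e u v : ℕ) {w : ℤ[X]} (hw : NonnegCoeff w) :
    (spreadPoly e).coeff 1 ≤ (nextPoly B Z e u v w).coeff 1 := by
  have h1 := NonnegCoeff.mul (nonnegCoeff_onePlusX_pow (e + 1)) hw.divX
  have h2 := coeff_one_le_onePlusX_pow_mul (NonnegCoeff.add h1 (nonnegCoeff_spreadPoly e)) (B + Z)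
  have h3 := NonnegCoeff.mul (NonnegCoeff.mul (nonnegCoeff_onePlusX_pow Z)
    (nonnegCoeff_geomPoly (u + e))) (nonnegCoeff_geomPoly B) 1
  have h4 := NonnegCoeff.mul (nonnegCoeff_geomPoly (v + B + e)) (nonnegCoeff_geomPoly Z) 1
  have h5 := h1 1
  rw [coeff_add] at h2
  rw [nextPoly, coeff_add, coeff_add]
  linarith

/-- The identity behind `DefectRelation.tail`. -/
lemma X_sq_mul_nextPoly (B Z e u v : ℕ) {w : ℤ[X]} (he : (e : ℤ) = w.coeff 0) :
    X ^ 2 * nextPoly B Z e u v w =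
      onePlusX ^ (B + Z + e) * (onePlusX * (X * w) + onePlusX ^ u + onePlusX ^ v - 1) -
        onePlusX ^ (u + Z + e) - onePlusX ^ (v + B + e) + 1 := by
  have hw : w = X * divX w + (e : ℤ[X]) := by
    conv_lhs => rw [← X_mul_divX_add w, ← he]
    simp
  have h1 := X_sq_mul_spreadPoly e
  have h2 := X_mul_geomPoly (u + e)
  have h3 := X_mul_geomPoly B
  have h4 := X_mul_geomPoly (v + B + e)
  have h5 := X_mul_geomPoly Z
  generalize divX w = d at hw
  subst hw
  have : X ^ 2 * nextPoly B Z e u v (X * d + (e : ℤ[X])) =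
    onePlusX ^ (B + Z) * (onePlusX ^ (e + 1) * X ^ 2 * d + X ^ 2 * spreadPoly e) +
    onePlusX ^ Z * (X * geomPoly (u + e)) * (X * geomPoly B) +
      (X * geomPoly (v + B + e)) * (X * geomPoly Z) := by
    have hd : divX (X * d + (e : ℤ[X])) = d := by
      ext i; simp [coeff_divX, coeff_X_mul]
    rw [nextPoly, hd]
    ring
  rw [this, h1, h2, h3, h4, h5]
  simp only [pow_add, pow_one]
  ring

/-- The defect relation passes to tails. The gap of `b` is the sum of the gaps of `c`, `d` and the
constant coefficient of `w`. -/
lemma DefectRelation.tail {n : ℕ} {b c d : ℕ → ℕ} {w : ℤ[X]} {u v e : ℕ}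
    (h : DefectRelation (n + 2) b c d w u v) (hb : b 1 < b 0) (hc : c 1 < c 0) (hd : d 1 < d 0)
    (he : (e : ℤ) = w.coeff 0) :
    gap b = gap c + gap d + e ∧ DefectRelation (n + 1) (tailSeq b) (tailSeq c) (tailSeq d)
      (nextPoly (gap c) (gap d) e u v w) (u + gap d + e) (v + gap c + e) := by
  obtain ⟨hw, hu, hv, hdvd⟩ := h
  have hE : cascadePoly (n + 2) b +
      onePlusX ^ (b 0 + 1) * (X ^ 2 * w + onePlusX ^ u + onePlusX ^ v - 1) -
      cascadePoly (n + 2) c - cascadePoly (n + 2) d =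
      X * (cascadePoly (n + 1) (tailSeq b) - cascadePoly (n + 1) (tailSeq c) -
        cascadePoly (n + 1) (tailSeq d) +
        onePlusX ^ b 0 * (onePlusX * (X * w) + onePlusX ^ u + onePlusX ^ v - 1)) := by
    rw [cascadePoly, cascadePoly.eq_def (n + 2) c, cascadePoly.eq_def (n + 2) d]
    simp only [hu, hv, pow_add, pow_one]
    have : (X : ℤ[X]) = onePlusX - 1 := by simp [onePlusX]
    linear_combination (onePlusX ^ b 0 * onePlusX ^ u + onePlusX ^ b 0 * onePlusX ^ v
      - onePlusX ^ b 0) * (-this)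
  rw [hE, show n + 2 + 1 = (n + 2) + 1 by ring, pow_succ', mul_dvd_mul_iff_left X_ne_zero] at hdvd
  have hc1 := (X_pow_dvd_iff.1 hdvd) 1 (by omega)
  rw [coeff_add, coeff_sub, coeff_sub, coeff_cascadePoly _ (by omega),
    coeff_cascadePoly _ (by omega), coeff_cascadePoly _ (by omega), mul_coeff_one,
    cascade_one, cascade_one, cascade_one] at hc1
  simp only [coeff_onePlusX_pow, coeff_sub, coeff_add, mul_coeff_one, mul_coeff_zero,
    coeff_X_zero, coeff_X_one, coeff_one_zero, tailSeq_apply] at hc1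
  have ho0 : onePlusX.coeff 0 = 1 := by simp [onePlusX]
  have h11 : (1 : ℤ[X]).coeff 1 = 0 := by
    rw [← C_1, coeff_C_of_ne_zero one_ne_zero]
  have ho1 : onePlusX.coeff 1 = 1 := by simp [onePlusX, h11]
  rw [ho0, ho1, h11, ← he] at hc1
  simp at hc1
  have hg : gap b = gap c + gap d + e := by
    unfold gap
    omega
  refine ⟨hg, nonnegCoeff_nextPoly _ _ _ _ _ hw, ?_, ?_, ?_⟩
  · simp only [tailSeq_apply, zero_add]; unfold gap at *; omega
  · simp only [tailSeq_apply, zero_add]; unfold gap at *; omega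
  · have hb0 : b 0 = (tailSeq b 0 + 1) + (gap c + gap d + e) := by
      rw [← hg]; simp only [tailSeq_apply, zero_add]; unfold gap; omega
    have key : onePlusX ^ (tailSeq b 0 + 1) * (X ^ 2 * nextPoly (gap c) (gap d) e u v w +
        onePlusX ^ (u + gap d + e) + onePlusX ^ (v + gap c + e) - 1) =
        onePlusX ^ b 0 * (onePlusX * (X * w) + onePlusX ^ u + onePlusX ^ v - 1) := by
      rw [X_sq_mul_nextPoly _ _ _ _ _ he, hb0, pow_add _ (tailSeq b 0 + 1)]
      ring
    rw [key, show n + 1 + 1 = n + 2 from rfl]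
    refine hdvd.trans (dvd_of_eq ?_)
    ring

lemma DefectRelation.exists_tail {n : ℕ} {b c d : ℕ → ℕ} {w : ℤ[X]} {u v : ℕ}
    (h : DefectRelation (n + 2) b c d w u v) (hb : b 1 < b 0) (hc : c 1 < c 0) (hd : d 1 < d 0) :
    ∃ e : ℕ, (e : ℤ) = w.coeff 0 ∧ gap b = gap c + gap d + e ∧
      DefectRelation (n + 1) (tailSeq b) (tailSeq c) (tailSeq d)
        (nextPoly (gap c) (gap d) e u v w) (u + gap d + e) (v + gap c + e) :=
  ⟨(w.coeff 0).toNat, Int.toNat_of_nonneg (h.nonneg 0),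
    h.tail hb hc hd (Int.toNat_of_nonneg (h.nonneg 0))⟩

/-- The last gap of `b` is at least that of `c`. -/
lemma DefectRelation.last_gap_le {n : ℕ} {b c d : ℕ → ℕ} {w : ℤ[X]} {u v : ℕ}
    (h : DefectRelation (n + 2) b c d w u v) (hb : DecreasingBelow (n + 2) b)
    (hc : DecreasingBelow (n + 2) c) (hd : DecreasingBelow (n + 2) d) :
    c n - c (n + 1) - 1 ≤ b n - b (n + 1) - 1 := by
  induction n generalizing b c d w u v with
  | zero =>
    obtain ⟨e, -, hg, -⟩ := h.exists_tail (hb 0 (by omega)) (hc 0 (by omega)) (hd 0 (by omega))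
    unfold gap at hg
    simp only [zero_add]
    omega
  | succ n ih =>
    obtain ⟨e, -, -, h'⟩ := h.exists_tail (hb 0 (by omega)) (hc 0 (by omega)) (hd 0 (by omega))
    exact ih h' hb.tail hc.tail hd.tail

/-- Doubly exponential growth: the constant coefficient `e` of `w` is at least squared and halved
when passing to tails, so the gaps of `b` grow doubly exponentially once `e > 2`. -/
lemma DefectRelation.pow_le_last_gap {n s : ℕ} {b c d : ℕ → ℕ} {w : ℤ[X]} {u v : ℕ}
    (h : DefectRelation (n + 2) b c d w u v) (hb : DecreasingBelow (n + 2) b)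
    (hc : DecreasingBelow (n + 2) c) (hd : DecreasingBelow (n + 2) d)
    (hs : 2 * 2 ^ 2 ^ s ≤ w.coeff 0) :
    2 * 2 ^ 2 ^ (s + n) ≤ b n - b (n + 1) - 1 := by
  induction n generalizing b c d w u v s with
  | zero =>
    obtain ⟨e, he, hg, -⟩ := h.exists_tail (hb 0 (by omega)) (hc 0 (by omega)) (hd 0 (by omega))
    rw [← he] at hs
    have hs' : 2 * 2 ^ 2 ^ s ≤ e := by exact_mod_cast hs
    unfold gap at hg
    simp only [zero_add, add_zero]
    omega
  | succ n ih =>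
    obtain ⟨e, he, hg, h'⟩ := h.exists_tail (hb 0 (by omega)) (hc 0 (by omega)) (hd 0 (by omega))
    have h1 := ih (s := s + 1) h' hb.tail hc.tail hd.tail ?_
    · rwa [show s + 1 + n = s + (n + 1) by ring] at h1
    · rw [coeff_zero_nextPoly]
      have h2 := two_mul_coeff_zero_spreadPoly e
      have h3 := h.nonneg 1
      have h4 : (0 : ℤ) ≤ (u + e) * gap c + (v + gap c + e) * gap d := by positivity
      rw [← he] at hs
      have h5 : (2 : ℤ) ^ 2 ^ (s + 1) = (2 ^ 2 ^ s) ^ 2 := by rw [pow_succ 2 s, pow_mul]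
      have h6 : (0 : ℤ) < 2 ^ 2 ^ s := by positivity
      rw [h5]
      nlinarith

/-- Four steps suffice to make the constant coefficient of `w` at least `32`, provided that it
does not vanish at the beginning or that the first gap of `c` does not. -/
lemma DefectRelation.pow_le_last_gap_of_nontrivial {n : ℕ} {b c d : ℕ → ℕ} {w : ℤ[X]} {u v : ℕ}
    (h : DefectRelation (n + 6) b c d w u v) (hb : DecreasingBelow (n + 6) b)
    (hc : DecreasingBelow (n + 6) c) (hd : DecreasingBelow (n + 6) d)
    (hu : 1 ≤ u) (hw : 1 ≤ w.coeff 0 ∨ 1 ≤ gap c) :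
    2 * 2 ^ 2 ^ (2 + n) ≤ b (n + 4) - b (n + 5) - 1 := by
  obtain ⟨e0, he0, -, h1⟩ := h.exists_tail (hb 0 (by omega)) (hc 0 (by omega)) (hd 0 (by omega))
  have p0 := two_mul_coeff_zero_spreadPoly e0
  have hw1 : 1 ≤ (nextPoly (gap c) (gap d) e0 u v w).coeff 0 := by
    rw [coeff_zero_nextPoly]
    have h3 := h.nonneg 1
    have h4 : (0 : ℤ) ≤ (v + gap c + e0) * gap d := by positivity
    have h6 : (0 : ℤ) ≤ (u + e0) * gap c := by positivity
    rcases hw with hw | hw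
    · rw [← he0] at hw
      nlinarith
    · have h5 : (1 : ℤ) ≤ (u + e0) * gap c := by
        have : 1 ≤ (u + e0) * gap c := Nat.mul_pos (by omega) hw
        exact_mod_cast this
      nlinarith [Int.natCast_nonneg e0]
  clear p0
  set w1 := nextPoly (gap c) (gap d) e0 u v w
  obtain ⟨e1, he1, -, h2⟩ := h1.exists_tail (hb.tail 0 (by omega)) (hc.tail 0 (by omega))
    (hd.tail 0 (by omega))
  have p1 := two_mul_coeff_zero_spreadPoly e1
  have q1 := one_le_coeff_one_spreadPoly (e := e1) (by rw [← he1] at hw1; exact_mod_cast hw1)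
  have r1 := (coeff_one_spreadPoly_le_nextPoly (gap (tailSeq c)) (gap (tailSeq d)) e1
    (u + gap d + e0) (v + gap c + e0) h1.nonneg)
  have hw2 : 2 ≤ (nextPoly (gap (tailSeq c)) (gap (tailSeq d)) e1 (u + gap d + e0)
      (v + gap c + e0) w1).coeff 0 := by
    rw [coeff_zero_nextPoly]
    have h3 := h1.nonneg 1
    have h4 : (0 : ℤ) ≤ (((u + gap d + e0 : ℕ) : ℤ) + e1) * gap (tailSeq c) +
      (((v + gap c + e0 : ℕ) : ℤ) + gap (tailSeq c) + e1) * gap (tailSeq d) := by positivity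
    rw [← he1] at hw1
    nlinarith
  set w2 := nextPoly (gap (tailSeq c)) (gap (tailSeq d)) e1 (u + gap d + e0)
      (v + gap c + e0) w1
  generalize u + gap d + e0 + gap (tailSeq d) + e1 = u2 at h2
  generalize v + gap c + e0 + gap (tailSeq c) + e1 = v2 at h2
  obtain ⟨e2, he2, -, h3⟩ := h2.exists_tail (hb.tail.tail 0 (by omega)) (hc.tail.tail 0 (by omega))
    (hd.tail.tail 0 (by omega))
  have p2 := two_mul_coeff_zero_spreadPoly e2
  have q2 := six_le_coeff_one_spreadPoly (e := e2) (by rw [← he2] at hw2; exact_mod_cast hw2)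
  have r2 := (coeff_one_spreadPoly_le_nextPoly (gap (tailSeq (tailSeq c)))
    (gap (tailSeq (tailSeq d))) e2 u2 v2 h2.nonneg)
  have hw3 : 6 ≤ (nextPoly (gap (tailSeq (tailSeq c))) (gap (tailSeq (tailSeq d))) e2 u2 v2
      w2).coeff 0 := by
    rw [coeff_zero_nextPoly]
    have h4 : (0 : ℤ) ≤ ((u2 : ℤ) + e2) * gap (tailSeq (tailSeq c)) +
      ((v2 : ℤ) + gap (tailSeq (tailSeq c)) + e2) * gap (tailSeq (tailSeq d)) := by positivity
    rw [← he2] at hw2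
    nlinarith
  set w3 := nextPoly (gap (tailSeq (tailSeq c))) (gap (tailSeq (tailSeq d))) e2 u2 v2 w2
  generalize u2 + gap (tailSeq (tailSeq d)) + e2 = u3 at h3
  generalize v2 + gap (tailSeq (tailSeq c)) + e2 = v3 at h3
  obtain ⟨e3, he3, -, h4⟩ := h3.exists_tail (hb.tail.tail.tail 0 (by omega))
    (hc.tail.tail.tail 0 (by omega)) (hd.tail.tail.tail 0 (by omega))
  refine h4.pow_le_last_gap hb.tail.tail.tail.tail hc.tail.tail.tail.tail
    hd.tail.tail.tail.tail (s := 2) ?_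
  rw [coeff_zero_nextPoly]
  have p3 := two_mul_coeff_zero_spreadPoly e3
  have h5 : (0 : ℤ) ≤ ((u3 : ℤ) + e3) * gap (tailSeq (tailSeq (tailSeq c))) +
    ((v3 : ℤ) + gap (tailSeq (tailSeq (tailSeq c))) + e3) *
      gap (tailSeq (tailSeq (tailSeq d))) := by positivity
  rw [← he3] at hw3
  norm_num
  nlinarith

/-- Up to degree `n`, the generating polynomials of `b` and of a sequence starting at `M` add up to
those of `c` and `d`. For `M = b 0` this is the relation between the face numbers of a family, of
its link at a vertex (with `c` lengthened by the first term `b 0`) and of its deletion. -/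
def PeelRelation (n M : ℕ) (b c d : ℕ → ℕ) : Prop :=
  X ^ (n + 1) ∣ cascadePoly n b + onePlusX ^ M - cascadePoly n c - cascadePoly n d

lemma PeelRelation.head_eq {n M : ℕ} {b c d : ℕ → ℕ} (h : PeelRelation (n + 1) M b c d) :
    c 0 + d 0 + 1 = b 0 + M := by
  have hc1 := (X_pow_dvd_iff.1 h) 1 (by omega)
  rw [coeff_sub, coeff_sub, coeff_add, coeff_cascadePoly _ (by omega),
    coeff_cascadePoly _ (by omega), coeff_cascadePoly _ (by omega),
    cascade_one, cascade_one, cascade_one, coeff_onePlusX_pow] at hc1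
  simp at hc1
  omega

lemma PeelRelation.tail {n M : ℕ} {b c d : ℕ → ℕ} (h : PeelRelation (n + 1) M b c d)
    (hM : d 0 + 1 = M) : PeelRelation n (M - 1) (tailSeq b) (tailSeq c) (tailSeq d) := by
  have h0 : c 0 = b 0 := by have := h.head_eq; omega
  subst hM
  unfold PeelRelation at h ⊢
  rw [pow_succ' X (n + 1)] at h
  have : cascadePoly (n + 1) b + onePlusX ^ (d 0 + 1) - cascadePoly (n + 1) c -
      cascadePoly (n + 1) d = X * (cascadePoly n (tailSeq b) + onePlusX ^ (d 0 + 1 - 1) -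
        cascadePoly n (tailSeq c) - cascadePoly n (tailSeq d)) := by
    rw [cascadePoly, cascadePoly.eq_def (n + 1) c, cascadePoly.eq_def (n + 1) d]
    simp only [h0, pow_succ, Nat.add_sub_cancel]
    have : (X : ℤ[X]) = onePlusX - 1 := by simp [onePlusX]
    linear_combination (-onePlusX ^ d 0) * this
  rw [this, mul_dvd_mul_iff_left X_ne_zero] at h
  exact h

/-- `b` without its first `p` terms. -/
def dropSeq (p : ℕ) (b : ℕ → ℕ) : ℕ → ℕ := fun i => b (p + i)

lemma PeelRelation.drop {n M p : ℕ} {b c d : ℕ → ℕ} (h : PeelRelation (n + p) M b c d)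
    (hd : ∀ i < p, d i + i + 1 = M) :
    PeelRelation n (M - p) (dropSeq p b) (dropSeq p c) (dropSeq p d) := by
  induction p generalizing M b c d with
  | zero =>
    have e : ∀ f : ℕ → ℕ, dropSeq 0 f = f := fun f => by funext i; simp [dropSeq]
    rwa [e, e, e]
  | succ p ih =>
    have h1 := PeelRelation.tail (n := n + p) h (by simpa using hd 0 (by omega))
    have h2 := ih h1 fun i hi => by have := hd (i + 1) (by omega); simp only [tailSeq_apply]; omega
    have e : ∀ f : ℕ → ℕ, dropSeq p (tailSeq f) = dropSeq (p + 1) f := fun f => by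
      funext i; simp only [dropSeq, tailSeq_apply]; congr 1; ring
    rwa [e, e, e, show M - 1 - p = M - (p + 1) by omega] at h2

/-- As long as `d` agrees with `M - 1, M - 2, …`, the sequence `c` agrees with `b`. -/
lemma PeelRelation.eq_of_lt {n M p : ℕ} {b c d : ℕ → ℕ} (h : PeelRelation (n + p) M b c d)
    (hd : ∀ i < p, d i + i + 1 = M) {i : ℕ} (hi : i < p) : c i = b i := by
  have h1 : PeelRelation (n + (p - i - 1) + 1 + i) M b c d := by
    rwa [show n + (p - i - 1) + 1 + i = n + p by omega]
  have h2 := (h1.drop fun j hj => hd j (by omega)).head_eq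
  have h3 := hd i hi
  simp only [dropSeq, add_zero] at h2
  omega

/-- Where `d` stops agreeing with `M - 1, M - 2, …`, a `DefectRelation` begins. -/
lemma PeelRelation.defectRelation {n M u : ℕ} {b c d : ℕ → ℕ}
    (h : PeelRelation (n + 1) M b c d) (hu : d 0 + u + 1 = M) (hb : b 0 ≤ d 0) :
    DefectRelation (n + 1) b c d (geomPoly u * geomPoly (d 0 - b 0)) u (d 0 - b 0) := by
  have h0 := h.head_eq
  refine ⟨NonnegCoeff.mul (nonnegCoeff_geomPoly _) (nonnegCoeff_geomPoly _), by omega, by omega, ?_⟩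
  have h1 := X_mul_geomPoly u
  have h2 := X_mul_geomPoly (d 0 - b 0)
  have h3 : X ^ 2 * (geomPoly u * geomPoly (d 0 - b 0)) + onePlusX ^ u + onePlusX ^ (d 0 - b 0) - 1
      = onePlusX ^ (u + (d 0 - b 0)) := by
    have : X ^ 2 * (geomPoly u * geomPoly (d 0 - b 0)) =
      (X * geomPoly u) * (X * geomPoly (d 0 - b 0)) := by ring
    rw [this, h1, h2, pow_add]
    ring
  rw [h3, ← pow_add, show b 0 + 1 + (u + (d 0 - b 0)) = M by omega]
  exact h

/-- The sequence with first term `a`, followed by the terms of `c`. -/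
def consSeq (a : ℕ) (c : ℕ → ℕ) : ℕ → ℕ
  | 0 => a
  | i + 1 => c i

lemma tailSeq_consSeq (a : ℕ) (c : ℕ → ℕ) : tailSeq (consSeq a c) = c := rfl

lemma DecreasingBelow.cons {k a : ℕ} {c : ℕ → ℕ} (hc : DecreasingBelow k c)
    (ha : 0 < k → c 0 < a) :
    DecreasingBelow (k + 1) (consSeq a c) := by
  intro i hi
  cases i with
  | zero => exact ha (by omega)
  | succ i => exact hc i (by omega)

lemma peelRelation_of_cascade_eq {k : ℕ} {b c d : ℕ → ℕ}
    (h : ∀ r < k, cascade b (r + 1) = cascade d (r + 1) + cascade c r) :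
    PeelRelation k (b 0) b (consSeq (b 0) c) d := by
  refine X_pow_dvd_iff.2 fun r hr => ?_
  rw [coeff_sub, coeff_sub, coeff_add, coeff_cascadePoly _ (by omega),
    coeff_cascadePoly _ (by omega), coeff_cascadePoly _ (by omega), coeff_onePlusX_pow]
  cases r with
  | zero => simp
  | succ r =>
    rw [h r (by omega), cascade_succ (consSeq (b 0) c), tailSeq_consSeq]
    simp only [consSeq]
    push_cast
    ring

end Polynomials

/-! ### Faces and nested families -/

section Faces

variable {α : Type*} [DecidableEq α]

/-- The `r`-subsets of the members of `S`. -/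
def faces (S : Finset (Finset α)) (r : ℕ) : Finset (Finset α) := S.biUnion (powersetCard r)

/-- The ground set of the family `S`. -/
def support (S : Finset (Finset α)) : Finset α := S.biUnion id

lemma mem_faces {S : Finset (Finset α)} {r : ℕ} {A : Finset α} :
    A ∈ faces S r ↔ ∃ B ∈ S, A ⊆ B ∧ #A = r := by
  simp [faces, mem_powersetCard]

lemma mem_support {S : Finset (Finset α)} {x : α} : x ∈ support S ↔ ∃ B ∈ S, x ∈ B := by
  simp [support]

lemma iterate_shadow_eq_faces {S : Finset (Finset α)} {k t : ℕ} (hS : (S : Set (Finset α)).Sized k)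
    (ht : t ≤ k) : ∂^[t] S = faces S (k - t) := by
  ext A
  rw [mem_shadow_iterate_iff_exists_mem_card_add, mem_faces]
  refine exists_congr fun B => and_congr_right fun hB => and_congr_right fun _ => ?_
  rw [hS (mem_coe.2 hB)]
  omega

lemma faces_self {S : Finset (Finset α)} {k : ℕ} (hS : (S : Set (Finset α)).Sized k) :
    faces S k = S := by simpa using (iterate_shadow_eq_faces hS (Nat.zero_le k)).symm

lemma memberSubfamily_faces (S : Finset (Finset α)) (x : α) (r : ℕ) :
    (faces S (r + 1)).memberSubfamily x = faces (S.memberSubfamily x) r := by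
  ext A
  simp only [mem_memberSubfamily, mem_faces]
  constructor
  · rintro ⟨⟨B, hB, hAB, hc⟩, hx⟩
    rw [card_insert_of_notMem hx] at hc
    have hxB : x ∈ B := hAB (mem_insert_self _ _)
    refine ⟨B.erase x, ⟨by rwa [insert_erase hxB], notMem_erase _ _⟩, fun a ha => ?_, by omega⟩
    exact mem_erase.2 ⟨fun h => hx (h ▸ ha), hAB (mem_insert_of_mem ha)⟩
  · rintro ⟨B, ⟨hB, hxB⟩, hAB, hc⟩
    have hx : x ∉ A := fun h => hxB (hAB h)
    exact ⟨⟨_, hB, insert_subset_insert _ hAB, by rw [card_insert_of_notMem hx, hc]⟩, hx⟩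

lemma nonMemberSubfamily_faces {S : Finset (Finset α)} {x : α}
    (h : S.memberSubfamily x ⊆ ∂ (S.nonMemberSubfamily x)) (r : ℕ) :
    (faces S r).nonMemberSubfamily x = faces (S.nonMemberSubfamily x) r := by
  ext A
  simp only [mem_nonMemberSubfamily, mem_faces]
  constructor
  · rintro ⟨⟨B, hB, hAB, hc⟩, hx⟩
    by_cases hxB : x ∈ B
    · obtain ⟨C, hC, hBC⟩ := exists_subset_of_mem_shadow (h (mem_memberSubfamily.2
        ⟨by rwa [insert_erase hxB], notMem_erase _ _⟩ : B.erase x ∈ _))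
      refine ⟨C, mem_nonMemberSubfamily.1 hC, fun a ha => hBC ?_, hc⟩
      exact mem_erase.2 ⟨fun h => hx (h ▸ ha), hAB ha⟩
    · exact ⟨B, ⟨hB, hxB⟩, hAB, hc⟩
  · rintro ⟨B, ⟨hB, hxB⟩, hAB, hc⟩
    exact ⟨⟨B, hB, hAB, hc⟩, fun h => hxB (hAB h)⟩

lemma faces_mono {S : Finset (Finset α)} {A B : Finset α} (hB : B ∈ faces S #B) (hAB : A ⊆ B) :
    A ∈ faces S #A := by
  obtain ⟨C, hC, hBC, -⟩ := mem_faces.1 hB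
  exact mem_faces.2 ⟨C, hC, hAB.trans hBC, rfl⟩

lemma faces_subset_powersetCard_support (S : Finset (Finset α)) (r : ℕ) :
    faces S r ⊆ powersetCard r (support S) := by
  intro A hA
  obtain ⟨B, hB, hAB, hc⟩ := mem_faces.1 hA
  exact mem_powersetCard.2 ⟨fun a ha => mem_support.2 ⟨B, hB, hAB ha⟩, hc⟩

lemma faces_one (S : Finset (Finset α)) : faces S 1 = powersetCard 1 (support S) := by
  refine (faces_subset_powersetCard_support S 1).antisymm fun A hA => ?_
  obtain ⟨hA, hc⟩ := mem_powersetCard.1 hA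
  obtain ⟨a, rfl⟩ := card_eq_one.1 hc
  obtain ⟨B, hB, ha⟩ := mem_support.1 (hA (mem_singleton_self a))
  exact mem_faces.2 ⟨B, hB, singleton_subset_iff.2 ha, hc⟩

lemma support_memberSubfamily_subset (S : Finset (Finset α)) (x : α) :
    support (S.memberSubfamily x) ⊆ (support S).erase x := by
  intro a ha
  obtain ⟨B, hB, haB⟩ := mem_support.1 ha
  obtain ⟨h1, h2⟩ := mem_memberSubfamily.1 hB
  exact mem_erase.2 ⟨fun h => h2 (h ▸ haB), mem_support.2 ⟨_, h1, mem_insert_of_mem haB⟩⟩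

/-- Families of `r`-subsets of `V` that are obtained from a complete family by repeatedly adding
a vertex to the ground set, either as an isolated vertex, or, raising `r` by one, so that the old
family becomes its link and all sets avoiding it are members. Up to isomorphism, these are the
initial segments of the colexicographic order. -/
inductive Nested : Finset α → ℕ → Finset (Finset α) → Prop
  | full (V : Finset α) (r : ℕ) : Nested V r (powersetCard r V)
  | skip {V : Finset α} {r : ℕ} {R : Finset (Finset α)} (x : α) (hx : x ∉ V) (h : Nested V r R) :
      Nested (insert x V) r R
  | cone {V : Finset α} {r : ℕ} {R : Finset (Finset α)} (x : α) (hx : x ∉ V) (h : Nested V r R) :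
      Nested (insert x V) (r + 1) (powersetCard (r + 1) V ∪ R.image (insert x))

lemma Nested.mono {V W : Finset α} {r : ℕ} {R : Finset (Finset α)} (h : Nested V r R)
    (hVW : V ⊆ W) : Nested W r R := by
  have : ∀ U : Finset α, Disjoint U V → Nested (U ∪ V) r R := by
    intro U
    induction U using Finset.induction_on with
    | empty => intro _; simpa using h
    | insert a U ha ih =>
      intro hd
      rw [disjoint_insert_left] at hd
      rw [insert_union]
      exact Nested.skip a (by simp [ha, hd.1]) (ih hd.2)
  have h2 := this (W \ V) sdiff_disjoint
  rwa [sdiff_union_of_subset hVW] at h2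

end Faces

/-! ### Face numbers -/

/-- The equality case of `cascade_le_choose`. -/
lemma consecutive_of_cascade_eq {p M : ℕ} {d : ℕ → ℕ} (hd : DecreasingBelow p d)
    (hM : 0 < p → d 0 < M) (h : cascade d p = M.choose p) (hpM : p ≤ M) :
    ∀ i < p, d i + i + 1 = M := by
  induction p generalizing M d with
  | zero => intro i hi; omega
  | succ p ih =>
    have h0 : d 0 + 1 = M := by
      by_contra h1
      have h2 := cascade_le_choose hd (Nat.lt_succ_self _)
      have h3 : (d 0 + 1).choose (p + 1) ≤ (M - 1).choose (p + 1) :=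
        Nat.choose_le_choose _ (by have := hM (by omega); omega)
      have h4 : (M - 1).choose p + (M - 1).choose (p + 1) = M.choose (p + 1) := by
        obtain ⟨N, rfl⟩ : ∃ N, M = N + 1 := ⟨M - 1, by omega⟩
        rw [Nat.choose_succ_succ]
        rfl
      have h5 : 0 < (M - 1).choose p := Nat.choose_pos (by omega)
      rw [Nat.succ_eq_add_one] at h2
      omega
    subst h0
    rw [cascade_succ, Nat.choose_succ_succ, add_comm] at h
    have h1 := ih (M := d 0) hd.tail (fun hp => hd 0 (by omega)) (by simpa using h) (by omega)
    intro i hi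
    cases i with
    | zero => rfl
    | succ i =>
      have := h1 i (by omega)
      simp only [tailSeq_apply] at this
      omega

lemma cascade_eq_choose {r M : ℕ} {d : ℕ → ℕ} (h : ∀ i < r, d i + i + 1 = M) :
    cascade d r = M.choose r := by
  induction r generalizing M d with
  | zero => simp
  | succ r ih =>
    obtain rfl := h 0 (by omega)
    rw [cascade_succ, add_zero, Nat.choose_succ_succ, add_comm, ih (M := d 0)]
    intro i hi
    have := h (i + 1) (by omega)
    simp only [tailSeq_apply]
    omega

/-- The cascade of a sequence `M - 1, M - 2, …, M - q` followed by `M - q - 2, M - q - 3, …` counts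
the `r`-subsets of an `M`-set that do not contain a given set of size `q + 1`. -/
lemma cascade_add_choose {q r M : ℕ} {d : ℕ → ℕ} (h1 : ∀ i < q, d i + i + 1 = M)
    (h2 : ∀ i, q ≤ i → i < r → d i + i + 2 = M) (hqr : q < r) :
    cascade d r + (M - (q + 1)).choose (r - (q + 1)) = M.choose r := by
  obtain ⟨s, rfl⟩ : ∃ s, r = q + 1 + s := ⟨r - (q + 1), by omega⟩
  rw [Nat.add_sub_cancel_left]
  clear hqr
  induction q generalizing M d with
  | zero =>
    have hM := h2 0 le_rfl (by omega)
    obtain ⟨N, rfl⟩ : ∃ N, M = N + 1 := ⟨M - 1, by omega⟩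
    rw [cascade_eq_choose (M := N) fun i hi => by have := h2 i (by omega) hi; omega]
    rw [zero_add, add_comm 1 s, Nat.choose_succ_succ, Nat.add_sub_cancel, add_comm]
  | succ q ih =>
    obtain rfl := h1 0 (by omega)
    have := ih (M := d 0) (d := tailSeq d)
      (fun i hi => by have := h1 (i + 1) (by omega); simp only [tailSeq_apply]; omega)
      (fun i hi hi' => by
        have := h2 (i + 1) (by omega) (by omega); simp only [tailSeq_apply]; omega)
    rw [show q + 1 + 1 + s = (q + 1 + s) + 1 by ring, cascade_succ, add_zero, Nat.choose_succ_succ,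
      ← this, show d 0 + 1 - (q + 1 + 1) = d 0 - (q + 1) by omega, Nat.succ_eq_add_one]
    ring

lemma Extremal.card_faces {n k : ℕ} (hk : 0 < k) {b : ℕ → ℕ} {S : Finset (Finset (Fin n))}
    (h : Extremal k b S) {r : ℕ} (hr : r ≤ k) : #(faces S r) = cascade b r := by
  have h1 := h.card_iterate_shadow hk (t := k - r) (by omega)
  rwa [iterate_shadow_eq_faces h.sized (by omega), show k - (k - r) = r by omega] at h1

lemma Extremal.card_support {n k : ℕ} (hk : 0 < k) {b : ℕ → ℕ} {S : Finset (Finset (Fin n))}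
    (h : Extremal k b S) : #(support S) = b 0 + 1 := by
  have h1 := h.card_faces hk (r := 1) hk
  rwa [faces_one, card_powersetCard, Nat.choose_one_right, cascade_one] at h1

/-! ### Splitting an extremal family at a vertex -/

/-- The decomposition of an extremal family at a vertex `x` whose link lies in the shadow of the
deletion: both the link and the deletion are extremal. -/
structure VertexSplit {n : ℕ} (k : ℕ) (b c d : ℕ → ℕ) (S : Finset (Finset (Fin n))) (x : Fin n) :
    Prop where
  pos : 0 < k
  base : Extremal (k + 1) b S
  link : Extremal k c (S.memberSubfamily x)
  deletion : Extremal (k + 1) d (S.nonMemberSubfamily x)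
  subset : S.memberSubfamily x ⊆ ∂ (S.nonMemberSubfamily x)

/-- A vertex `x` of a minimal non-face `X` splits an extremal family. If the link contained the
shadow of the deletion, a member containing `X.erase x` could be turned into one containing `X`. -/
lemma Extremal.exists_vertexSplit {n k : ℕ} (hk : 0 < k) {b : ℕ → ℕ} {S : Finset (Finset (Fin n))}
    (h : Extremal (k + 1) b S) {X : Finset (Fin n)} (hXV : X ⊆ support S) (hX : X ∉ faces S #X)
    (hmin : ∀ Y ⊆ support S, #Y < #X → Y ∈ faces S #Y) (hXk : #X ≤ k + 1) {x : Fin n}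
    (hx : x ∈ X) : ∃ c d, VertexSplit k b c d S x := by
  have hne : (S.memberSubfamily x).Nonempty := by
    obtain ⟨B, hB, hxB⟩ := mem_support.1 (hXV hx)
    exact ⟨B.erase x, mem_memberSubfamily.2 ⟨by rwa [insert_erase hxB], notMem_erase _ _⟩⟩
  obtain ⟨⟨c, hc⟩, hsub | ⟨hsub, d, hd⟩⟩ := h.link hk hne
  · exfalso
    have hcard := card_erase_add_one hx
    obtain ⟨A, hA, hXA, -⟩ := mem_faces.1 (hmin (X.erase x) ((erase_subset _ _).trans hXV)
      (by omega))
    by_cases hxA : x ∈ A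
    · refine hX (mem_faces.2 ⟨A, hA, ?_, rfl⟩)
      rw [← insert_erase hx]
      exact insert_subset hxA hXA
    · have hAc : #A = k + 1 := h.sized (mem_coe.2 hA)
      obtain ⟨y, hyA, hyX⟩ := exists_mem_notMem_of_card_lt_card (s := X.erase x) (t := A) (by omega)
      have h1 := hsub (erase_mem_shadow (mem_nonMemberSubfamily.2 ⟨hA, hxA⟩) hyA)
      refine hX (mem_faces.2 ⟨_, (mem_memberSubfamily.1 h1).1, ?_, rfl⟩)
      rw [← insert_erase hx]
      refine insert_subset_insert _ fun a ha => mem_erase.2 ⟨fun h => hyX (h ▸ ha), hXA ha⟩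
  · exact ⟨c, d, hk, h, hc, hd, hsub⟩

namespace VertexSplit

variable {n k : ℕ} {b c d : ℕ → ℕ} {S : Finset (Finset (Fin n))} {x : Fin n}

lemma cascade_eq (h : VertexSplit k b c d S x) {r : ℕ} (hr : r < k + 1) :
    cascade b (r + 1) = cascade d (r + 1) + cascade c r := by
  rw [← h.base.card_faces (Nat.succ_pos k) (r := r + 1) (by omega),
    ← h.link.card_faces h.pos (r := r) (by omega),
    ← h.deletion.card_faces (Nat.succ_pos k) (r := r + 1) (by omega),
    ← memberSubfamily_faces, ← nonMemberSubfamily_faces h.subset, add_comm (card _),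
    card_memberSubfamily_add_card_nonMemberSubfamily]

lemma mem_support (h : VertexSplit k b c d S x) : x ∈ support S := by
  obtain ⟨A, hA⟩ := h.link.nonempty
  exact _root_.mem_support.2 ⟨_, (mem_memberSubfamily.1 hA).1, mem_insert_self _ _⟩

lemma support_deletion_subset (S : Finset (Finset (Fin n))) (x : Fin n) :
    support (S.nonMemberSubfamily x) ⊆ (support S).erase x := by
  intro a ha
  obtain ⟨B, hB, haB⟩ := _root_.mem_support.1 ha
  obtain ⟨h1, h2⟩ := mem_nonMemberSubfamily.1 hB
  exact mem_erase.2 ⟨fun h => h2 (h ▸ haB), _root_.mem_support.2 ⟨_, h1, haB⟩⟩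

lemma card_support_erase (h : VertexSplit k b c d S x) : #((support S).erase x) = b 0 := by
  rw [card_erase_of_mem h.mem_support, h.base.card_support (Nat.succ_pos k), Nat.add_sub_cancel]

lemma deletion_zero (h : VertexSplit k b c d S x) : d 0 + 1 = b 0 := by
  have := h.cascade_eq (r := 0) (by omega)
  rw [cascade_one, cascade_one, cascade_zero] at this
  omega

lemma link_zero_lt (h : VertexSplit k b c d S x) : c 0 < b 0 := by
  have h1 := card_le_card (support_memberSubfamily_subset S x)
  rw [h.link.card_support h.pos, h.card_support_erase] at h1
  omega

lemma le_zero (h : VertexSplit k b c d S x) : k + 1 ≤ b 0 := by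
  have h1 := h.deletion.decreasing.le_zero (j := k) (by omega)
  have := h.deletion_zero
  omega

lemma peelRelation (h : VertexSplit k b c d S x) :
    PeelRelation (k + 1) (b 0) b (consSeq (b 0) c) d :=
  peelRelation_of_cascade_eq fun _ hr => h.cascade_eq hr

lemma decreasing_cons (h : VertexSplit k b c d S x) :
    DecreasingBelow (k + 1) (consSeq (b 0) c) :=
  h.link.decreasing.cons fun _ => h.link_zero_lt

lemma mem_faces_insert {A : Finset (Fin n)} (hx : x ∉ A) {r : ℕ} :
    insert x A ∈ faces S (r + 1) ↔ A ∈ faces (S.memberSubfamily x) r := by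
  rw [← memberSubfamily_faces, mem_memberSubfamily, and_iff_left hx]

lemma mem_faces_of_notMem (h : VertexSplit k b c d S x) {A : Finset (Fin n)} (hx : x ∉ A)
    {r : ℕ} : A ∈ faces S r ↔ A ∈ faces (S.nonMemberSubfamily x) r := by
  rw [← nonMemberSubfamily_faces h.subset, mem_nonMemberSubfamily, and_iff_left hx]

end VertexSplit

lemma faces_eq_powersetCard_iff {n : ℕ} {T : Finset (Finset (Fin n))} {W : Finset (Fin n)}
    (hTW : support T ⊆ W) {r : ℕ} :
    faces T r = powersetCard r W ↔ #(faces T r) = (#W).choose r := by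
  rw [← card_powersetCard]
  refine ⟨fun h => by rw [h], fun h => eq_of_subset_of_card_le ?_ h.ge⟩
  exact (faces_subset_powersetCard_support T r).trans (powersetCard_mono hTW)

/-- All sets of at most `p` vertices of `S` that avoid `x` are contained in members of `S`. -/
def CompleteOff {n : ℕ} (S : Finset (Finset (Fin n))) (x : Fin n) (p : ℕ) : Prop :=
  ∀ A ⊆ support S, #A ≤ p → x ∉ A → A ∈ faces S #A

/-- Completeness off `x` can be read off from the sequence `d` of the deletion. -/
lemma VertexSplit.completeOff_iff {n k : ℕ} {b c d : ℕ → ℕ} {S : Finset (Finset (Fin n))}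
    {x : Fin n} (h : VertexSplit k b c d S x) {p : ℕ} (hp : p ≤ k + 1) :
    CompleteOff S x p ↔ ∀ i < p, d i + i + 1 = b 0 := by
  have hcard := h.card_support_erase
  have hsub := VertexSplit.support_deletion_subset S x
  have hle := h.le_zero
  constructor
  · intro hc
    refine consecutive_of_cascade_eq (h.deletion.decreasing.mono hp)
      (fun _ => by have := h.deletion_zero; omega) ?_ (by omega)
    rw [← h.deletion.card_faces (Nat.succ_pos k) hp, ← hcard, ← faces_eq_powersetCard_iff hsub]
    refine ((faces_subset_powersetCard_support _ _).trans (powersetCard_mono hsub)).antisymm ?_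
    intro A hA
    obtain ⟨hA, hAc⟩ := mem_powersetCard.1 hA
    have hx : x ∉ A := fun hx => notMem_erase x _ (hA hx)
    have := hc A (hA.trans (erase_subset _ _)) hAc.le hx
    rwa [h.mem_faces_of_notMem hx, hAc] at this
  · intro hd A hA hAp hx
    rw [h.mem_faces_of_notMem hx, (faces_eq_powersetCard_iff hsub).2, mem_powersetCard]
    · exact ⟨fun a ha => mem_erase.2 ⟨fun e => hx (e ▸ ha), hA ha⟩, rfl⟩
    · rw [h.deletion.card_faces (Nat.succ_pos k) (by omega), hcard]
      exact cascade_eq_choose fun i hi => hd i (by omega)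

/-- If the face numbers of `T` are those of the complex of all sets not containing a given set of
size `q + 1`, then, up to sets of size `m`, it is such a complex. -/
lemma exists_core {n : ℕ} {T : Finset (Finset (Fin n))} {W : Finset (Fin n)}
    (hTW : support T ⊆ W) {q m : ℕ} (hqm : q < m) (h1 : ∀ r ≤ q, #(faces T r) = (#W).choose r)
    (h2 : ∀ r, q < r → r ≤ m →
      #(faces T r) + (#W - (q + 1)).choose (r - (q + 1)) = (#W).choose r) :
    ∃ Y ⊆ W, #Y = q + 1 ∧ ∀ A ⊆ W, #A ≤ m → (A ∈ faces T #A ↔ ¬ Y ⊆ A) := by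
  have hsub : ∀ r, faces T r ⊆ powersetCard r W := fun r =>
    (faces_subset_powersetCard_support T r).trans (powersetCard_mono hTW)
  have hcard : ∀ r, q < r → r ≤ m →
      #(powersetCard r W \ faces T r) = (#W - (q + 1)).choose (r - (q + 1)) := by
    intro r hr hrm
    have := h2 r hr hrm
    rw [card_sdiff_of_subset (hsub r), card_powersetCard]
    omega
  obtain ⟨Y, hY⟩ := card_eq_one.1 ((hcard (q + 1) (by omega) hqm).trans (by simp))
  have hYm : Y ∈ powersetCard (q + 1) W \ faces T (q + 1) := by rw [hY]; exact mem_singleton_self Y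
  obtain ⟨hYm, hYT⟩ := mem_sdiff.1 hYm
  obtain ⟨hYW, hYc⟩ := mem_powersetCard.1 hYm
  refine ⟨Y, hYW, hYc, fun A hA hAm => ?_⟩
  have hnot : ∀ B, Y ⊆ B → B ∉ faces T #B := fun B hYB hB => hYT (hYc ▸ faces_mono hB hYB)
  refine ⟨fun hAT hYA => hnot A hYA hAT, fun hYA => ?_⟩
  by_cases hAq : #A ≤ q
  · rw [(faces_eq_powersetCard_iff hTW).2 (h1 _ hAq), mem_powersetCard]
    exact ⟨hA, rfl⟩
  -- The supersets of `Y` of size `#A` are as numerous as the sets of this size that are not faces.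
  by_contra hAT
  have hle : ((powersetCard (#A - (q + 1)) (W \ Y)).image (· ∪ Y)) ⊆
      powersetCard #A W \ faces T #A := by
    intro B hB
    obtain ⟨C, hC, rfl⟩ := mem_image.1 hB
    obtain ⟨hC, hCc⟩ := mem_powersetCard.1 hC
    have hdis : Disjoint C Y := disjoint_of_subset_left hC sdiff_disjoint
    have hBc : #(C ∪ Y) = #A := by rw [card_union_of_disjoint hdis]; omega
    refine mem_sdiff.2 ⟨mem_powersetCard.2 ⟨union_subset (hC.trans sdiff_subset) hYW, hBc⟩, ?_⟩
    rw [← hBc]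
    exact hnot _ subset_union_right
  have hinj : Set.InjOn (· ∪ Y) (powersetCard (#A - (q + 1)) (W \ Y) : Set (Finset (Fin n))) := by
    intro C hC D hD hCD
    have key : ∀ E ∈ powersetCard (#A - (q + 1)) (W \ Y), (E ∪ Y) \ Y = E := fun E hE => by
      have hdis : Disjoint E Y :=
        disjoint_of_subset_left (mem_powersetCard.1 hE).1 sdiff_disjoint
      rw [union_sdiff_right, sdiff_eq_self_of_disjoint hdis]
    rw [← key C hC, ← key D hD]
    exact congrArg (· \ Y) hCD
  have heq := eq_of_subset_of_card_le hle (by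
    rw [card_image_of_injOn hinj, hcard _ (by omega) hAm, card_powersetCard,
      card_sdiff_of_subset hYW, hYc])
  have hAmem : A ∈ powersetCard #A W \ faces T #A :=
    mem_sdiff.2 ⟨mem_powersetCard.2 ⟨hA, rfl⟩, hAT⟩
  rw [← heq] at hAmem
  obtain ⟨C, -, rfl⟩ := mem_image.1 hAmem
  exact hYA subset_union_right

namespace VertexSplit

variable {n k : ℕ} {b c d : ℕ → ℕ} {S : Finset (Finset (Fin n))} {x : Fin n}

/-- If `p` is maximal such that the family is complete off `x` up to level `p`, then `d i` is
`b 0 - 1 - i` for `i < p`, but less for `i = p`. -/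
lemma deletion_lt (h : VertexSplit k b c d S x) {p : ℕ} (hpk : p < k + 1)
    (hp : CompleteOff S x p) (hp1 : ¬ CompleteOff S x (p + 1)) : d p + p + 1 < b 0 := by
  have h1 := (h.completeOff_iff hpk.le).1 hp
  have h2 := h.deletion.decreasing.le_zero hpk
  have h3 := h.deletion_zero
  refine lt_of_le_of_ne (by omega) fun h4 => hp1 ((h.completeOff_iff hpk).2 fun i hi => ?_)
  rcases Nat.lt_succ_iff_lt_or_eq.1 hi with hi | rfl
  · exact h1 i hi
  · exact h4

/-- The link of a vertex of a non-face `X` of size at most `p + 2` is not complete at level `p + 1`,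
so the sequence `c` is not `b 0 - 1, b 0 - 2, …` up to the index `p`. -/
lemma link_add_lt (h : VertexSplit k b c d S x) {X : Finset (Fin n)} (hXV : X ⊆ support S)
    (hX : X ∉ faces S #X) (hx : x ∈ X) {p : ℕ} (hpk : p < k) (hXp : #X ≤ p + 2) :
    c p + p + 1 < b 0 := by
  by_contra hlt
  have h0 := h.link_zero_lt
  have hcons : ∀ i < p + 1, c i + i + 1 = b 0 := by
    intro i hi
    have h1 := h.link.decreasing.le_zero (j := i) (by omega)
    have h2 := h.link.decreasing.add_le (i := i) (j := p) (by omega) hpk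
    omega
  have hcard := card_erase_add_one hx
  have hXe : X.erase x ∉ faces (S.memberSubfamily x) #(X.erase x) := by
    rwa [← mem_faces_insert (notMem_erase x X), insert_erase hx, hcard]
  refine hXe ?_
  rw [(faces_eq_powersetCard_iff (support_memberSubfamily_subset S x)).2, mem_powersetCard]
  · exact ⟨erase_subset_erase _ hXV, rfl⟩
  · rw [h.link.card_faces h.pos (by omega), h.card_support_erase]
    exact cascade_eq_choose fun i hi => hcons i (by omega)

/-- The last gap of the size of a link bounds the last gap of the size of the family, because the
sequences for the link and the family agree up to the index `p` and satisfy a `DefectRelation`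
beyond. -/
lemma link_last_gap_le {k : ℕ} (h : VertexSplit (k + 2) b c d S x) {X : Finset (Fin n)}
    (hXV : X ⊆ support S) (hX : X ∉ faces S #X) (hx : x ∈ X) {p : ℕ} (hpk : p ≤ k + 3)
    (hp0 : 0 < p) (hXp : #X ≤ p + 1) (hp : CompleteOff S x p)
    (hp1 : p < k + 3 → ¬ CompleteOff S x (p + 1)) :
    c k - c (k + 1) - 1 ≤ b (k + 1) - b (k + 2) - 1 := by
  have hd := (h.completeOff_iff hpk).1 hp
  have hP := h.peelRelation
  obtain rfl | hlt := hpk.eq_or_lt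
  · have h1 := PeelRelation.eq_of_lt (n := 0) (by simpa using hP) hd (i := k + 1) (by omega)
    have h2 := PeelRelation.eq_of_lt (n := 0) (by simpa using hP) hd (i := k + 2) (by omega)
    simp only [consSeq] at h1 h2
    omega
  have hdp := h.deletion_lt hlt hp (hp1 hlt)
  obtain ⟨p, rfl⟩ := Nat.exists_eq_add_of_lt hp0
  simp only [zero_add] at *
  have hcp := (h.link_add_lt hXV hX hx (p := p) (by omega) (by omega))
  obtain ⟨m, hm⟩ : ∃ m, k + 2 + 1 = m + 1 + (p + 1) := ⟨k + 2 - (p + 1), by omega⟩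
  have hP' : PeelRelation (m + 1 + (p + 1)) (b 0) b (consSeq (b 0) c) d := hm ▸ hP
  have hD := hP'.drop hd
  have hh := hD.head_eq
  simp only [dropSeq, add_zero, consSeq] at hh
  rcases m with _ | m
  · obtain rfl : p = k + 1 := by omega
    have h1 := hP'.eq_of_lt hd (i := k + 1) (by omega)
    simp only [consSeq] at h1
    rw [show k + 1 + 1 = k + 2 from rfl] at hh hdp
    omega
  · have hrel := PeelRelation.defectRelation (u := b 0 - (p + 1) - d (p + 1) - 1) hD
      (by simp only [dropSeq, add_zero]; omega) (by simp only [dropSeq, add_zero]; omega)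
    have hdrop : ∀ {f : ℕ → ℕ}, DecreasingBelow (k + 3) f →
        DecreasingBelow (m + 2) (dropSeq (p + 1) f) := fun hf i hi => by
      have := hf (p + 1 + i) (by omega)
      simpa only [dropSeq, add_assoc] using this
    have := hrel.last_gap_le (hdrop h.base.decreasing) (hdrop h.decreasing_cons)
      (hdrop h.deletion.decreasing)
    simp only [dropSeq] at this
    rwa [show p + 1 + m = k + 1 by omega, show p + 1 + (m + 1) = k + 2 by omega] at this

/-- If `x` is, among the vertices of the non-face `X`, one off which the family is complete as far
as possible, and if this level of completeness is far from the top, then the last gap is large: the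
doubly exponential growth can fail to start only if all non-faces of the link on the next levels
contain a common subset of `X`, whose vertices would be better choices than `x`. -/
lemma pow_le_last_gap {m p : ℕ} (h : VertexSplit (m + p + 5) b c d S x) {X : Finset (Fin n)}
    (hXV : X ⊆ support S) (hX : X ∉ faces S #X) (hx : x ∈ X) (hp0 : 0 < p)
    (hXp : #X ≤ p + 1) (hp : CompleteOff S x p) (hp1 : ∀ y ∈ X, ¬ CompleteOff S y (p + 1)) :
    2 * 2 ^ 2 ^ (2 + m) ≤ b (p + (m + 4)) - b (p + (m + 5)) - 1 := by
  have hd := (h.completeOff_iff (by omega)).1 hp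
  have hdp := h.deletion_lt (by omega) hp (hp1 x hx)
  obtain ⟨p, rfl⟩ := Nat.exists_eq_add_of_lt hp0
  simp only [zero_add] at *
  have hcp := (h.link_add_lt hXV hX hx (p := p) (by omega) (by omega))
  have hP : PeelRelation (m + 6 + (p + 1)) (b 0) b (consSeq (b 0) c) d := by
    have := h.peelRelation
    rwa [show m + (p + 1) + 5 + 1 = m + 6 + (p + 1) by omega] at this
  have hD := hP.drop hd
  have hh := hD.head_eq
  simp only [dropSeq, add_zero, consSeq] at hh
  have hrel := PeelRelation.defectRelation (u := b 0 - (p + 1) - d (p + 1) - 1) hD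
    (by simp only [dropSeq, add_zero]; omega) (by simp only [dropSeq, add_zero]; omega)
  have hdrop : ∀ {f : ℕ → ℕ}, DecreasingBelow (m + (p + 1) + 6) f →
      DecreasingBelow (m + 6) (dropSeq (p + 1) f) := fun hf i hi => by
    have := hf (p + 1 + i) (by omega)
    simpa only [dropSeq, add_assoc] using this
  refine hrel.pow_le_last_gap_of_nontrivial (hdrop h.base.decreasing) (hdrop h.decreasing_cons)
    (hdrop h.deletion.decreasing) (by omega) ?_
  rw [or_iff_not_imp_left]
  intro hw
  rw [Polynomial.mul_coeff_zero, coeff_zero_geomPoly, coeff_zero_geomPoly] at hw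
  simp only [dropSeq, add_zero, gap, consSeq] at hw ⊢
  have hv : d (p + 1) - b (p + 1) = 0 := by
    by_contra hne
    refine hw ?_
    have h1 : 1 ≤ b 0 - (p + 1) - d (p + 1) - 1 := by omega
    have h2 : 1 ≤ d (p + 1) - b (p + 1) := by omega
    exact_mod_cast Nat.mul_pos h1 h2
  have hcp2 : c p + p + 2 = b 0 := by omega
  show 1 ≤ c p - c (p + 1) - 1
  by_contra hgap
  have hlt := h.link.decreasing p (by omega)
  have hcp3 : c (p + 1) + p + 3 = b 0 := by omega
  -- The sequence `c` is `b 0 - 1, …, b 0 - q`, followed by `b 0 - q - 2, …, b 0 - p - 3`.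
  obtain ⟨q, ⟨hqp, hq⟩, hmin⟩ : ∃ q, (q ≤ p ∧ c q + q + 2 = b 0) ∧
      ∀ i < q, ¬ (i ≤ p ∧ c i + i + 2 = b 0) :=
    ⟨_, Nat.find_spec (p := fun q => q ≤ p ∧ c q + q + 2 = b 0) ⟨p, le_rfl, hcp2⟩,
      fun i hi => Nat.find_min _ hi⟩
  have hc0 := h.link_zero_lt
  have hlow : ∀ i < q, c i + i + 1 = b 0 := by
    intro i hi
    have h1 := h.link.decreasing.le_zero (j := i) (by omega)
    have h2 := h.link.decreasing.add_le (i := i) (j := p) (by omega) (by omega)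
    have h3 := hmin i hi
    omega
  have hhigh : ∀ i, q ≤ i → i < p + 2 → c i + i + 2 = b 0 := by
    intro i hi hi'
    have h1 := h.link.decreasing.add_le hi (by omega)
    have h2 := h.link.decreasing.add_le (i := i) (j := p + 1) (by omega) (by omega)
    omega
  have hW := h.card_support_erase
  obtain ⟨Y, hYW, hYc, hY⟩ := exists_core (support_memberSubfamily_subset S x) (q := q)
    (m := p + 2) (by omega)
    (fun r hr => by
      rw [h.link.card_faces h.pos (by omega), hW]
      exact cascade_eq_choose fun i hi => hlow i (by omega))
    (fun r hr hrp => by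
      rw [h.link.card_faces h.pos (by omega), hW]
      exact cascade_add_choose hlow (fun i hi hi' => hhigh i hi (by omega)) hr)
  have hcard := card_erase_add_one hx
  have hYX : Y ⊆ X.erase x := by
    by_contra hYX
    have := (hY _ (erase_subset_erase _ hXV) (by omega)).2 hYX
    rw [← mem_faces_insert (notMem_erase x X), insert_erase hx, hcard] at this
    exact hX this
  -- The family is complete off each vertex of `Y` up to level `p + 2`.
  obtain ⟨y, hy⟩ : Y.Nonempty := card_pos.1 (by omega)
  refine hp1 y (mem_of_mem_erase (hYX hy)) fun A hA hAp hyA => ?_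
  by_cases hxA : x ∈ A
  · have hAc := card_erase_add_one hxA
    have := (hY (A.erase x) (erase_subset_erase _ hA) (by omega)).2
      fun hYA => hyA (mem_of_mem_erase (hYA hy))
    rwa [← mem_faces_insert (notMem_erase x A), insert_erase hxA, hAc] at this
  · have hAW : A ⊆ (support S).erase x := fun a ha => mem_erase.2 ⟨fun e => hxA (e ▸ ha), hA ha⟩
    obtain ⟨B, hB, hAB, -⟩ := mem_faces.1 ((hY A hAW hAp).2 fun hYA => hyA (hYA hy))
    exact mem_faces.2 ⟨_, (mem_memberSubfamily.1 hB).1, hAB.trans (subset_insert _ _), rfl⟩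

end VertexSplit

/-! ### The last gap of an extremal family -/

/-- If the family is complete off `x`, then its faces form a cone over the faces of the link. -/
lemma nested_of_link {n r : ℕ} {S : Finset (Finset (Fin n))} {x : Fin n} (hx : x ∈ support S)
    (hc : CompleteOff S x (r + 1))
    (h : Nested (support (S.memberSubfamily x)) r (faces (S.memberSubfamily x) r)) :
    Nested (support S) (r + 1) (faces S (r + 1)) := by
  have h1 := Nested.cone x (notMem_erase x _) (h.mono (support_memberSubfamily_subset S x))
  rw [insert_erase hx] at h1
  convert h1 using 1
  ext A
  rw [mem_union, mem_image]
  constructor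
  · intro hA
    by_cases hxA : x ∈ A
    · refine Or.inr ⟨A.erase x, ?_, insert_erase hxA⟩
      rwa [← VertexSplit.mem_faces_insert (notMem_erase x A), insert_erase hxA]
    · obtain ⟨hAV, hAc⟩ := mem_powersetCard.1 (faces_subset_powersetCard_support S _ hA)
      exact Or.inl (mem_powersetCard.2
        ⟨fun a ha => mem_erase.2 ⟨fun e => hxA (e ▸ ha), hAV ha⟩, hAc⟩)
  · rintro (hA | ⟨B, hB, rfl⟩)
    · obtain ⟨hAW, hAc⟩ := mem_powersetCard.1 hA
      rw [← hAc]
      exact hc A (hAW.trans (erase_subset _ _)) hAc.le fun hxA => notMem_erase x _ (hAW hxA)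
    · have hxB : x ∉ B := fun hxB => notMem_erase x _
        (support_memberSubfamily_subset S x ((mem_powersetCard.1
          (faces_subset_powersetCard_support _ _ hB)).1 hxB))
      rwa [VertexSplit.mem_faces_insert hxB]

/-- If an iterated shadow of an extremal family is not `Nested`, then the last gap of the sequence
`b` that encodes the size of the family is doubly exponential in the number of iterations, which is
`s + 5` for the `r`-sets. -/
theorem Extremal.pow_le_last_gap {n : ℕ} (r s : ℕ) {b : ℕ → ℕ} {S : Finset (Finset (Fin n))}
    (h : Extremal (r + s + 5) b S) (hN : ¬ Nested (support S) r (faces S r)) :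
    2 * 2 ^ 2 ^ (2 + s) ≤ b (r + s + 3) - b (r + s + 4) - 1 := by
  induction r generalizing b S with
  | zero =>
    refine absurd ?_ hN
    have : faces S 0 = powersetCard 0 (support S) := by
      rw [faces_eq_powersetCard_iff Subset.rfl, h.card_faces (by omega) (Nat.zero_le _)]
      simp
    rw [this]
    exact Nested.full _ _
  | succ q ih =>
    have h' : Extremal (q + s + 5 + 1) b S := by
      rwa [show q + s + 5 + 1 = q + 1 + s + 5 by omega]
    obtain ⟨Z, hZV, hZ⟩ : ∃ Z ∈ powersetCard (q + 1) (support S), Z ∉ faces S (q + 1) := by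
      by_contra! hall
      have := (faces_subset_powersetCard_support S (q + 1)).antisymm hall
      exact hN (this ▸ Nested.full _ _)
    obtain ⟨hZV, hZc⟩ := mem_powersetCard.1 hZV
    -- `X` is a non-face of minimal size.
    obtain ⟨X, hXm, hXmin⟩ := exists_min_image
      ((support S).powerset.filter fun X => X ∉ faces S #X) card
      ⟨Z, mem_filter.2 ⟨mem_powerset.2 hZV, by rwa [hZc]⟩⟩
    obtain ⟨hXV, hX⟩ := mem_filter.1 hXm
    rw [mem_powerset] at hXV
    have hXq : #X ≤ q + 1 := hZc ▸ hXmin Z (mem_filter.2 ⟨mem_powerset.2 hZV, by rwa [hZc]⟩)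
    have hmin : ∀ Y ⊆ support S, #Y < #X → Y ∈ faces S #Y := by
      intro Y hY hYX
      by_contra hYf
      exact absurd (hXmin Y (mem_filter.2 ⟨mem_powerset.2 hY, hYf⟩)) (by omega)
    have hX2 : 2 ≤ #X := by
      obtain ⟨B, hB⟩ := h.nonempty
      by_contra hlt
      interval_cases hXc : #X
      · rw [card_eq_zero] at hXc
        exact hX (mem_faces.2 ⟨B, hB, by simp [hXc], hXc ▸ card_empty⟩)
      · rw [faces_one, mem_powersetCard] at hX
        exact hX ⟨hXV, hXc⟩
    have h0 : ∀ x, CompleteOff S x (#X - 1) := fun x A hA hAX _ => hmin A hA (by omega)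
    classical
    -- `x` is a vertex of `X` off which `S` is complete as far as possible.
    obtain ⟨x, hx, hxmax⟩ := exists_max_image X
      (fun x => Nat.findGreatest (CompleteOff S x) (q + s + 5 + 1)) (card_pos.1 (by omega))
    obtain ⟨p, hp⟩ : ∃ p, Nat.findGreatest (CompleteOff S x) (q + s + 5 + 1) = p := ⟨_, rfl⟩
    simp only [hp] at hxmax
    have hpc : CompleteOff S x p :=
      hp ▸ Nat.findGreatest_spec (m := #X - 1) (by omega) (h0 x)
    have hpX : #X - 1 ≤ p := hp ▸ Nat.le_findGreatest (by omega) (h0 x)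
    have hpk : p ≤ q + s + 5 + 1 := hp ▸ Nat.findGreatest_le _
    have hp1 : p < q + s + 5 + 1 → ∀ y ∈ X, ¬ CompleteOff S y (p + 1) := fun hlt y hy hyc => by
      have h1 := Nat.le_findGreatest (P := CompleteOff S y) (n := q + s + 5 + 1) (by omega) hyc
      have h2 := hxmax y hy
      omega
    obtain ⟨c, d, hs⟩ := h'.exists_vertexSplit (by omega) hXV hX hmin (by omega) hx
    rcases Nat.lt_or_ge q p with hqp | hqp
    · have hlink := ih hs.link fun hN' => hN (nested_of_link hs.mem_support
        (fun A hA hAp hxA => hpc A hA (by omega) hxA) hN')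
      have := VertexSplit.link_last_gap_le (k := q + s + 3) hs hXV hX hx hpk (by omega) (by omega)
        hpc fun hlt => hp1 hlt x hx
      rw [show q + 1 + s + 3 = q + s + 3 + 1 by omega, show q + 1 + s + 4 = q + s + 3 + 2 by omega]
      exact hlink.trans this
    · obtain ⟨m, hm⟩ : ∃ m, q + s = m + p := ⟨q + s - p, by omega⟩
      rw [hm] at hs hp1
      have := hs.pow_le_last_gap hXV hX hx (by omega) (by omega) hpc (hp1 (by omega))
      rw [show q + 1 + s + 3 = p + (m + 4) by omega, show q + 1 + s + 4 = p + (m + 5) by omega]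
      refine le_trans ?_ this
      have : s ≤ m := by omega
      gcongr <;> omega

/-! ### Nested families as initial segments -/

/-- A `Nested` family becomes an initial segment of the colexicographic order when the vertices
are numbered in the order in which they are added. -/
lemma Nested.exists_numbering {α : Type*} [DecidableEq α] {V : Finset α} {r : ℕ}
    {R : Finset (Finset α)} (h : Nested V r R) :
    R ⊆ powersetCard r V ∧ ∃ f : α → ℕ, V.image f = range #V ∧ ∀ A ∈ R, ∀ B ∈ powersetCard r V,
      toColex (B.image f) < toColex (A.image f) → B ∈ R := by
  induction h with
  | full V r =>
    refine ⟨Subset.rfl, ?_⟩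
    obtain ⟨f, hf⟩ : ∃ f : α → ℕ, V.image f = range #V := by
      induction V using Finset.induction_on with
      | empty => exact ⟨fun _ => 0, by simp⟩
      | insert x V hx ih =>
        obtain ⟨f, hf⟩ := ih
        refine ⟨Function.update f x #V, ?_⟩
        rw [image_insert, Function.update_self, card_insert_of_notMem hx, range_add_one, ← hf]
        congr 1
        exact image_congr fun y hy => Function.update_of_ne (by rintro rfl; exact hx hy) _ _
    exact ⟨f, hf, fun A _ B hB _ => hB⟩
  | @skip V r R x hx _ ih =>
    obtain ⟨hR, f, hf, hI⟩ := ih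
    have hup : ∀ A ⊆ V, A.image (Function.update f x #V) = A.image f := fun A hA =>
      image_congr fun y hy => Function.update_of_ne (by rintro rfl; exact hx (hA hy)) _ _
    refine ⟨hR.trans (powersetCard_mono (subset_insert _ _)), Function.update f x #V, ?_, ?_⟩
    · rw [image_insert, Function.update_self, hup V Subset.rfl, card_insert_of_notMem hx,
        range_add_one, hf]
    · intro A hA B hB hBA
      have hAV := (mem_powersetCard.1 (hR hA)).1
      obtain ⟨hBV, hBc⟩ := mem_powersetCard.1 hB
      have hxB : x ∉ B := by
        intro hxB
        rw [hup A hAV, Colex.toColex_lt_toColex_iff_exists_forall_lt] at hBA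
        obtain ⟨a, haA, -, ha⟩ := hBA
        have h1 : ∀ a ∈ A.image f, a < #V := fun a ha =>
          mem_range.1 (hf ▸ image_subset_image hAV ha)
        have h2 := ha #V (mem_image.2 ⟨x, hxB, Function.update_self _ _ _⟩)
          fun h => lt_irrefl _ (h1 _ h)
        exact absurd (h1 a haA) (by omega)
      have hBV' : B ⊆ V := (subset_insert_iff_of_notMem hxB).1 hBV
      rw [hup A hAV, hup B hBV'] at hBA
      exact hI A hA B (mem_powersetCard.2 ⟨hBV', hBc⟩) hBA
  | @cone V r R x hx _ ih =>
    obtain ⟨hR, f, hf, hI⟩ := ih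
    have hup : ∀ A ⊆ V, A.image (Function.update f x #V) = A.image f := fun A hA =>
      image_congr fun y hy => Function.update_of_ne (by rintro rfl; exact hx (hA hy)) _ _
    have hlt : ∀ A ⊆ V, ∀ a ∈ A.image f, a < #V := fun A hA a ha =>
      mem_range.1 (hf ▸ image_subset_image hA ha)
    refine ⟨?_, Function.update f x #V, ?_, ?_⟩
    · refine union_subset (powersetCard_mono (subset_insert _ _)) fun A hA => ?_
      obtain ⟨B, hB, rfl⟩ := mem_image.1 hA
      obtain ⟨hBV, hBc⟩ := mem_powersetCard.1 (hR hB)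
      rw [mem_powersetCard, card_insert_of_notMem fun h => hx (hBV h), hBc]
      exact ⟨insert_subset_insert _ hBV, rfl⟩
    · rw [image_insert, Function.update_self, hup V Subset.rfl, card_insert_of_notMem hx,
        range_add_one, hf]
    · intro A hA B hB hBA
      obtain ⟨hBV, hBc⟩ := mem_powersetCard.1 hB
      by_cases hxB : x ∈ B
      · have hBe : B.erase x ⊆ V := by rwa [← subset_insert_iff]
        have hBec := card_erase_add_one hxB
        rw [Colex.toColex_lt_toColex_iff_exists_forall_lt] at hBA
        obtain ⟨a, haA, haB, ha⟩ := hBA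
        have hVB : #V ∈ B.image (Function.update f x #V) :=
          mem_image.2 ⟨x, hxB, Function.update_self _ _ _⟩
        rcases mem_union.1 hA with hA | hA
        · have hAV := (mem_powersetCard.1 hA).1
          rw [hup A hAV] at haA ha
          have h2 := ha #V hVB fun h => lt_irrefl _ (hlt A hAV _ h)
          exact absurd (hlt A hAV a haA) (by omega)
        · obtain ⟨C, hC, rfl⟩ := mem_image.1 hA
          have hCV := (mem_powersetCard.1 (hR hC)).1
          refine mem_union_right _ (mem_image.2 ⟨B.erase x, ?_, insert_erase hxB⟩)
          refine hI C hC _ (mem_powersetCard.2 ⟨hBe, by omega⟩) ?_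
          rw [← insert_erase hxB, image_insert, Function.update_self, hup _ hBe] at haB ha
          rw [image_insert, Function.update_self, hup _ hCV] at haA ha
          rw [Colex.toColex_lt_toColex_iff_exists_forall_lt]
          rw [mem_insert, not_or] at haB
          refine ⟨a, (mem_insert.1 haA).resolve_left haB.1, haB.2, fun e he heC => ?_⟩
          refine ha e (mem_insert_of_mem he) fun h => ?_
          rcases mem_insert.1 h with rfl | h
          · exact lt_irrefl _ (hlt _ hBe _ he)
          · exact heC h
      · exact mem_union_left _ (mem_powersetCard.2
          ⟨(subset_insert_iff_of_notMem hxB).1 hBV, hBc⟩)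

lemma Nested.isoColexSegment {n r : ℕ} {V : Finset (Fin n)} {R : Finset (Finset (Fin n))}
    (h : Nested V r R) : IsoColexSegment r #R R := by
  obtain ⟨hR, f, hf, hI⟩ := (h.mono (subset_univ V)).exists_numbering
  rw [card_univ, Fintype.card_fin] at hf
  have hinj : Function.Injective f := by
    rw [← Set.injOn_univ, ← coe_univ]
    exact injOn_of_card_image_eq (by rw [hf, card_range, card_univ, Fintype.card_fin])
  have hlt : ∀ x, f x < n := fun x => mem_range.1 (hf ▸ mem_image_of_mem f (mem_univ x))
  have hginj : Function.Injective fun x => (⟨f x, hlt x⟩ : Fin n) := fun x y hxy =>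
    hinj (Fin.mk.inj_iff.1 hxy)
  let σ : Equiv.Perm (Fin n) := Equiv.ofBijective _ (Finite.injective_iff_bijective.1 hginj)
  have hσ : ∀ A : Finset (Fin n), (A.image σ).image Fin.val = A.image f := fun A => by
    rw [image_image]
    rfl
  have hcard : ∀ A : Finset (Fin n), #(A.image σ) = #A := fun A =>
    card_image_of_injective _ σ.injective
  refine ⟨R.image fun A => A.image σ, ⟨⟨?_, ?_⟩, ?_⟩, σ, rfl⟩
  · intro A hA
    obtain ⟨B, hB, rfl⟩ := mem_image.1 (mem_coe.1 hA)
    rw [hcard, (mem_powersetCard.1 (hR hB)).2]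
  · rintro A' B hA' ⟨hBA, hB⟩
    obtain ⟨A, hA, rfl⟩ := mem_image.1 hA'
    obtain ⟨B, rfl⟩ : ∃ C : Finset (Fin n), C.image σ = B :=
      ⟨B.image σ.symm, by rw [image_image]; simp⟩
    rw [hcard] at hB
    refine mem_image_of_mem _ (hI A hA B (mem_powersetCard.2 ⟨subset_univ _, hB⟩) ?_)
    rw [← hσ, ← hσ]
    exact (Colex.toColex_image_lt_toColex_image Fin.val_strictMono).2 hBA
  · exact card_image_of_injective _ (image_injective σ.injective)

/-! ### Binomial decompositions -/

/-- A binomial decomposition `a` is turned into a sequence `b` of full length without changing the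
associated numbers, by expanding the last binomial coefficient. -/
lemma exists_cascade_eq_seqChoose {ℓ k : ℕ} (a : Fin (ℓ + 1) → ℕ) (hk : ℓ + 1 ≤ k)
    (ha : StrictAnti a) (hka : ∀ i : Fin (ℓ + 1), k ≤ a i + i) :
    ∃ b, DecreasingBelow k b ∧ b 0 ≤ a 0 ∧ ∀ r ≤ k, cascade b r = seqChoose a r := by
  induction ℓ generalizing k with
  | zero =>
    have h0 := hka 0
    simp only [Fin.val_zero, add_zero] at h0
    refine ⟨fun i => a 0 - 1 - i, fun i hi => by dsimp only; omega, by dsimp only; omega,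
      fun r hr => ?_⟩
    rw [cascade_eq_choose (M := a 0) fun i hi => by omega]
    simp [seqChoose]
  | succ ℓ ih =>
    obtain ⟨k, rfl⟩ : ∃ l, k = l + 1 := ⟨k - 1, by omega⟩
    obtain ⟨b, hb, hb0, hbr⟩ := ih (k := k) (fun i => a i.succ) (by omega)
      (fun i j hij => ha (Fin.succ_lt_succ_iff.2 hij))
      (fun i => by have := hka i.succ; simp only [Fin.val_succ] at this; omega)
    have h01 : a (Fin.succ 0) < a 0 := ha (Fin.succ_pos 0)
    refine ⟨consSeq (a 0) b, hb.cons fun _ => by omega, le_rfl, fun r hr => ?_⟩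
    cases r with
    | zero =>
      rw [cascade_zero, seqChoose, Fin.sum_univ_succ]
      simp
    | succ r =>
      have hsum : seqChoose a (r + 1) = (a 0).choose (r + 1) + seqChoose (fun i => a i.succ) r := by
        rw [seqChoose, Fin.sum_univ_succ]
        simp [seqChoose]
      rw [cascade_succ, tailSeq_consSeq, hbr r (by omega), hsum]
      rfl

lemma IsBinomialDecomposition.exists_cascade_eq {k m ℓ : ℕ} {a : Fin ℓ → ℕ}
    (h : IsBinomialDecomposition k m a) :
    ∃ b, DecreasingBelow k b ∧ cascade b k = m ∧ ∀ r ≤ k, cascade b r = seqChoose a r := by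
  obtain ⟨ℓ, rfl⟩ : ∃ l, ℓ = l + 1 := ⟨ℓ - 1, by have := h.one_le_length; omega⟩
  obtain ⟨b, hb, -, hbr⟩ := exists_cascade_eq_seqChoose a h.length_le h.strictAnti h.le_coeff
  exact ⟨b, hb, (hbr k le_rfl).trans h.sum_eq, hbr⟩

lemma IsBinomialDecomposition.seqChoose_eq {k ℓ : ℕ} {a : Fin ℓ → ℕ} {b : ℕ → ℕ}
    (hb : DecreasingBelow k b) (h : IsBinomialDecomposition k (cascade b k) a) {r : ℕ}
    (hr : r ≤ k) : seqChoose a r = cascade b r := by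
  obtain ⟨c, hc, hck, hcr⟩ := h.exists_cascade_eq
  rw [← hcr r hr]
  exact (cascade_mono hc hb hck.le hr).antisymm (cascade_mono hb hc hck.ge hr)

lemma IsExtremalFamily.exists_extremal {n k : ℕ} {S : Finset (Finset (Fin n))}
    (h : IsExtremalFamily k S) : ∃ b, Extremal k b S := by
  obtain ⟨-, hs, ℓ, a, ha, hS⟩ := h
  obtain ⟨b, hb, hbk, hbr⟩ := ha.exists_cascade_eq
  exact ⟨b, hb, hs, hbk.symm, by rw [hS, hbr _ (by omega)]⟩

/-! ### Depth of extremal families -/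

lemma Extremal.isoColexSegment_of_nested {n k t : ℕ} {b : ℕ → ℕ} {S : Finset (Finset (Fin n))}
    (hk : 0 < k) (h : Extremal k b S) (ht : t ≤ k)
    (hN : Nested (support S) (k - t) (faces S (k - t))) :
    IsoColexSegment (k - t) (cascade b (k - t)) (∂^[t] S) := by
  rw [iterate_shadow_eq_faces h.sized ht, ← h.card_faces hk (by omega)]
  exact hN.isoColexSegment

lemma Extremal.le_card {n k : ℕ} {b : ℕ → ℕ} {S : Finset (Finset (Fin n))}
    (h : Extremal k b S) : k ≤ n := by
  obtain ⟨A, hA⟩ := h.nonempty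
  have h1 := card_le_univ A
  rwa [h.sized (mem_coe.2 hA), Fintype.card_fin] at h1

/-- Shadows consisting of sets of size at most one, and families on at most two vertices, are
complete on their support. -/
lemma Extremal.nested_of_le_one_or_le_two {n k t : ℕ} {b : ℕ → ℕ} {S : Finset (Finset (Fin n))}
    (hk : 0 < k) (h : Extremal k b S) (hr : k - t ≤ 1 ∨ n ≤ 2) :
    Nested (support S) (k - t) (faces S (k - t)) := by
  suffices faces S (k - t) = powersetCard (k - t) (support S) by
    rw [this]; exact Nested.full _ _
  have hkn := h.le_card
  obtain h0 | h1 | ⟨h2, h3, h4⟩ :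
      k - t = 0 ∨ k - t = 1 ∨ k - t = k ∧ k = 2 ∧ n = 2 := by omega
  · rw [h0, faces_eq_powersetCard_iff Subset.rfl, h.card_faces hk (Nat.zero_le _)]
    simp
  · rw [h1, faces_one]
  · rw [h2]
    refine (faces_subset_powersetCard_support S k).antisymm fun A hA => ?_
    obtain ⟨B, hB⟩ := h.nonempty
    have hu : ∀ C : Finset (Fin n), #C = k → C = univ := fun C hC =>
      eq_univ_of_card C (by rw [hC, Fintype.card_fin]; omega)
    rw [faces_self h.sized, hu A (mem_powersetCard.1 hA).2, ← hu B (h.sized (mem_coe.2 hB))]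
    exact hB

/-- An iterated shadow that is not an initial segment forces the ground set to be large. -/
lemma Extremal.pow_lt_of_not_isoColexSegment {n k t : ℕ} {b : ℕ → ℕ}
    {S : Finset (Finset (Fin n))} (h : Extremal k b S) (ht : t ≤ k) (ht5 : 5 ≤ t)
    (hN : ¬ IsoColexSegment (k - t) (cascade b (k - t)) (∂^[t] S)) : 2 * 2 ^ 2 ^ (t - 3) < n := by
  have hk : 0 < k := by omega
  obtain ⟨s, rfl⟩ := Nat.exists_eq_add_of_le' ht5
  have hN' := mt (h.isoColexSegment_of_nested hk ht) hN
  obtain ⟨r, rfl⟩ := Nat.exists_eq_add_of_le' ht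
  rw [show r + (s + 5) = r + s + 5 by omega, show r + s + 5 - (s + 5) = r by omega] at *
  have h1 := h.pow_le_last_gap r s hN'
  have h2 := lt_of_card_eq_cascade h.sized h.card_eq.ge hk
  have h3 := h.decreasing.le_zero (j := r + s + 3) (by omega)
  rw [show s + 5 - 3 = 2 + s by omega]
  omega

lemma lt_of_pow_lt {n t : ℕ} (ht : 5 ≤ t) (h : 2 ^ 2 ^ (t - 3) < n) :
    (t : ℝ) < 2 * Real.log (Real.log n) + 4 := by
  obtain ⟨y, rfl⟩ := Nat.exists_eq_add_of_le' (show 3 ≤ t by omega)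
  rw [Nat.add_sub_cancel] at h
  have h1 : (2 : ℝ) ^ 2 ^ y < n := by exact_mod_cast h
  have h2 := Real.log_lt_log (by positivity) h1
  rw [Real.log_pow] at h2
  have hl := Real.log_two_gt_d9
  have h3 : (2 : ℝ) ^ y / 2 < Real.log n := by
    have : (0 : ℝ) < 2 ^ y := by positivity
    push_cast at h2
    nlinarith
  have h4 := Real.log_lt_log (by positivity) h3
  rw [Real.log_div (by positivity) (by norm_num), Real.log_pow] at h4
  have hy : (2 : ℝ) ≤ y := by exact_mod_cast (show 2 ≤ y by omega)
  push_cast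
  nlinarith

lemma le_logb_of_pow_lt {n j : ℕ} (hj : 6 ≤ j) (h : 2 * 2 ^ 2 ^ (j - 1 - 3) < n) :
    (j : ℝ) ≤ Real.logb 2 (Real.logb 2 n) + 4 := by
  obtain ⟨y, rfl⟩ := Nat.exists_eq_add_of_le' (show 4 ≤ j by omega)
  rw [show y + 4 - 1 - 3 = y by omega] at h
  have h1 : (2 : ℝ) ^ 2 ^ y ≤ n := by
    have : 2 ^ 2 ^ y ≤ n := by
      have : 0 < 2 ^ 2 ^ y := by positivity
      omega
    exact_mod_cast this
  have h2 := Real.logb_le_logb_of_le (b := 2) (by norm_num) (by positivity) h1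
  rw [Real.logb_pow, Real.logb_self_eq_one (by norm_num), mul_one] at h2
  push_cast at h2
  have h3 := Real.logb_le_logb_of_le (b := 2) (by norm_num) (by positivity) h2
  rw [Real.logb_pow, Real.logb_self_eq_one (by norm_num), mul_one] at h3
  push_cast
  linarith

theorem theorem5 (k : ℕ) (hk : 1 ≤ k) :
    (∃ c : ℝ, 0 < c ∧
      ∀ (n : ℕ) (S : Finset (Finset (Fin n))), IsExtremalFamily k S →
        ∀ (ℓ : ℕ) (a : Fin ℓ → ℕ), IsBinomialDecomposition k S.card a →
          ∀ t : ℕ, t ≤ k → c * Real.log (Real.log n) ≤ t →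
            IsoColexSegment (k - t) (seqChoose a (k - t)) (∂^[t] S)) ∧
    (∀ (n : ℕ) (S : Finset (Finset (Fin n))), IsExtremalFamily k S →
      ∃ j : ℕ, IsDepth k S j ∧
        (j : ℝ) ≤ max (Real.logb 2 (Real.logb 2 n) + 4) 5) := by
  constructor
  · have hl3 : 0 < Real.log (Real.log 3) := by
      refine Real.log_pos ?_
      rw [Real.lt_log_iff_exp_lt (by norm_num)]
      exact Real.exp_one_lt_three
    -- This `c` satisfies `c * log (log n) ≥ 5 + 2 * log (log n)` for all `n ≥ 3`.
    refine ⟨5 / Real.log (Real.log 3) + 2, by positivity, fun n S hS ℓ a ha t ht hct => ?_⟩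
    obtain ⟨b, hb⟩ := hS.exists_extremal
    rw [hb.card_eq] at ha
    rw [ha.seqChoose_eq hb.decreasing (by omega)]
    by_contra hN
    rcases Nat.lt_or_ge 2 n with hn | hn
    · have h3 : Real.log (Real.log 3) ≤ Real.log (Real.log n) := by
        have h0 : (3 : ℝ) ≤ n := by exact_mod_cast hn
        exact Real.log_le_log (Real.log_pos (by norm_num))
          (Real.log_le_log (by norm_num) h0)
      have h4 : 5 ≤ 5 / Real.log (Real.log 3) * Real.log (Real.log n) := by
        rw [div_mul_eq_mul_div, le_div_iff₀ hl3]
        linarith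
      have ht5 : 5 ≤ t := by
        have : (5 : ℝ) ≤ t := by linarith
        exact_mod_cast this
      have h5 := hb.pow_lt_of_not_isoColexSegment ht ht5 hN
      have h6 := lt_of_pow_lt (n := n) ht5 (by omega)
      linarith
    · exact hN (hb.isoColexSegment_of_nested hk ht (hb.nested_of_le_one_or_le_two hk (Or.inr hn)))
  · intro n S hS
    obtain ⟨b, hb⟩ := hS.exists_extremal
    have hex : ∃ i, i < k ∧ ∃ m, IsoColexSegment (k - i) m (∂^[i] S) :=
      ⟨k - 1, by omega, _, hb.isoColexSegment_of_nested hk (by omega)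
        (hb.nested_of_le_one_or_le_two hk (Or.inl (by omega)))⟩
    classical
    refine ⟨Nat.find hex, ⟨Nat.find_spec hex, fun i hi => Nat.find_min' hex hi⟩, ?_⟩
    rcases Nat.lt_or_ge 5 (Nat.find hex) with hj | hj
    · have hjk := (Nat.find_spec hex).1
      have hN := Nat.find_min hex (m := Nat.find hex - 1) (by omega)
      refine le_max_of_le_left (le_logb_of_pow_lt hj (hb.pow_lt_of_not_isoColexSegment
        (by omega) (by omega) fun h => hN ⟨by omega, _, h⟩))
    · exact le_max_of_le_right (by exact_mod_cast hj)
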